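/- Let $n\ge 1$, let $\langle z,w\rangle=\sum_j z_j\bar w_j$ on $\mathbb C^n$, and let $\mathscr L(\mathbb C^n)_+$ be the set of positive definite Hermitian $n\times n$ matrices, with the distance $\mathrm{dist}$ given by the Hilbert–Schmidt norm. For $z\ne0$ let $\Pi_z$ be the orthogonal projector of $\mathbb C^n$ onto the line $\mathbb C z$. Let $\nu$ be a non-zero finite Borel measure on $\mathbb{C}P^{n-1}$, put $|\nu|=\nu(\mathbb{C}P^{n-1})$, and define Donaldson's map $T_\nu:\mathscr L(\mathbb C^n)_+\to\mathscr L(\mathbb C^n)_+$ by $$T_\nu(G)=\frac{n}{|\nu|}\int_{\mathbb{C}P^{n-1}}\Pi_z\,\frac{|z|^2}{\langle G^{-1}z,z\rangle}\,d\nu([z]).$$ Suppose that $\nu$ is supported on a closed complex variety $Y\subset\mathbb{C}P^{n-1}$ and is absolutely continuous on every irreducible component $Z$ of $Y$ (that is, $\nu$ vanishes on the Borel subsets of $Z$ of zero $2\dim_{\mathbb C}Z$-dimensional volume). Assume moreover that (i) for every non-empty proper projective subspace $\Sigma\subset\mathbb{C}P^{n-1}$, $$\frac{\nu(\Sigma)}{\dim\Sigma+1}<\frac{|\nu|}{n};$$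 (ii) at least one irreducible component of $Y$ is not contained in any proper projective subspace of $\mathbb{C}P^{n-1}$. Then for every $G_0\in\mathscr L(\mathbb C^n)_+$ all the iterates $T_\nu^r(G_0)$ are well defined in $\mathscr L(\mathbb C^n)_+$, and there exist a fixed point $G_\infty\in\mathscr L(\mathbb C^n)_+$ of $T_\nu$ and constants $C>0$ and $\beta\in(0,1)$ such that $$\mathrm{dist}\big(T_\nu^r(G_0),G_\infty\big)\le C\beta^r\qquad\text{for all } r\in\mathbb N.$$ -/

import Mathlib

open MeasureTheory
open scoped LinearAlgebra.Projectivization Matrix Matrix.Norms.Frobenius ComplexOrder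

noncomputable section

namespace Donaldson

/-- The complex projective space `ℂP^{n-1}` of lines in `ℂ^n`. -/
abbrev CProj (n : ℕ) : Type := ℙ ℂ (Fin n → ℂ)

/-- The classical topology on `ℂP^{n-1}`: the quotient topology from `ℂ^n ∖ {0}`. -/
instance instTopologicalSpaceCProj (n : ℕ) : TopologicalSpace (CProj n) :=
  inferInstanceAs
    (TopologicalSpace (Quotient (projectivizationSetoid ℂ (Fin n → ℂ))))

/-- The Borel `σ`-algebra of the classical topology. -/
instance instMeasurableSpaceCProj (n : ℕ) : MeasurableSpace (CProj n) := borel (CProj n)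

instance instBorelSpaceCProj (n : ℕ) : BorelSpace (CProj n) := ⟨rfl⟩

/-! ### Complex projective varieties -/

/-- The Zariski topology on `ℂP^{n-1}`: its closed sets are the common zero loci of families of
homogeneous polynomials. (The nonvanishing loci of homogeneous polynomials are stable under finite
intersections, so they form a basis.) -/
@[reducible] def zariski (n : ℕ) : TopologicalSpace (CProj n) :=
  TopologicalSpace.generateFrom
    {U | ∃ (f : MvPolynomial (Fin n) ℂ) (d : ℕ), f.IsHomogeneous d ∧
      U = {x : CProj n | MvPolynomial.eval x.rep f ≠ 0}}

/-- `Y` is a (closed, possibly reducible) complex variety in `ℂP^{n-1}`. -/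
def IsVariety {n : ℕ} (Y : Set (CProj n)) : Prop := @IsClosed _ (zariski n) Y

/-- `Z` is an irreducible component of `Y`: a maximal (Zariski) irreducible subset. -/
def IsComponent {n : ℕ} (Y Z : Set (CProj n)) : Prop :=
  Maximal (fun S : Set (CProj n) => S ⊆ Y ∧ @IsIrreducible _ (zariski n) S) Z

/-- The complex dimension of `Z ⊆ ℂP^{n-1}`: the Krull dimension for the Zariski topology. -/
def varietyDim {n : ℕ} (Z : Set (CProj n)) : WithBot ℕ∞ :=
  @topologicalKrullDim Z ((zariski n).induced Subtype.val)

/-! ### Rank one projectors -/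

/-- The Hermitian product `⟨z, w⟩ = ∑ j, z j * conj (w j)` on `ℂ^n`. -/
def herm {n : ℕ} (z w : Fin n → ℂ) : ℂ := ∑ j, z j * star (w j)

/-- The orthogonal projector `Π_z` of `ℂ^n` onto the line spanned by `z ≠ 0`:
its matrix entries are `z i * conj (z j) / |z|²`. -/
def lineProj {n : ℕ} (z : Fin n → ℂ) : Matrix (Fin n) (Fin n) ℂ :=
  Matrix.of fun i j => z i * star (z j) / herm z z

/-- The embedding `[z] ↦ Π_z` of `ℂP^{n-1}` in the Euclidean space of `n × n` matrices with the
Hilbert-Schmidt norm. It induces a multiple of the Fubini-Study metric. -/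
def projEmb {n : ℕ} (x : CProj n) : EuclideanSpace ℂ (Fin n × Fin n) :=
  WithLp.toLp 2 fun p => lineProj x.rep p.1 p.2

/-- `ν` is absolutely continuous on the irreducible variety `Z` of complex dimension `d`: it does
not charge the subsets of `Z` of zero `2d`-dimensional volume. The volume of `Z` is taken as the
`2d`-dimensional Hausdorff measure, which up to a constant is the Riemannian volume on the smooth
part of `Z` and which vanishes on the singular part. -/
def AbsContOn {n : ℕ} (ν : Measure (CProj n)) (Z : Set (CProj n)) : Prop :=
  ∃ d : ℕ, varietyDim Z = d ∧
    ∀ N : Set (CProj n), N ⊆ Z → MeasurableSet N →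
      Measure.hausdorffMeasure (2 * d : ℝ) (projEmb '' N) = 0 → ν N = 0

/-! ### Donaldson's map -/

/-- Donaldson's map
`T_ν(G) = (n / |ν|) ∫ Π_z |z|² / ⟨G⁻¹ z, z⟩ dν([z])`;
the integrand does not depend on the representative `z` of the point `[z]`. -/
def T {n : ℕ} (ν : Measure (CProj n)) (G : Matrix (Fin n) (Fin n) ℂ) :
    Matrix (Fin n) (Fin n) ℂ :=
  ((n : ℝ) / ν.real Set.univ) •
    ∫ x : CProj n, (herm x.rep x.rep / herm (G⁻¹ *ᵥ x.rep) x.rep) • lineProj x.rep ∂ν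

end Donaldson

end

/-!
# Exponential convergence of Donaldson's iteration

The stability condition (i) alone gives the convergence. After a measurable choice of a unit vector
`z` on each line, the functional `H ↦ ∫ log ⟨H z, z⟩ - log det H / n` is coercive modulo scaling, and
its minima are the inverses of the fixed points. In coordinates in which the identity is fixed, the
trace decreases along the iteration by an amount that is quadratic in the distance to the scalar
matrices, and the linearisation `A ↦ n ∫ ⟨A z, z⟩ z z*` has a spectral gap on trace free Hermitian
matrices.
-/

noncomputable section

namespace Donaldson

open Matrix Filter Topology

variable {n : ℕ} {X : Type*} [MeasurableSpace X]

/-- The topology of the Frobenius norm, syntactically. -/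
local instance frobeniusTopology : TopologicalSpace (Matrix (Fin n) (Fin n) ℂ) :=
  (frobeniusNormedAddCommGroup (m := Fin n) (n := Fin n)
    (α := ℂ)).toPseudoMetricSpace.toUniformSpace.toTopologicalSpace

/-! ### Quadratic forms and rank one matrices -/

/-- The real quadratic form `v ↦ re ⟨A v, v⟩` of a complex matrix. -/
def qf (A : Matrix (Fin n) (Fin n) ℂ) (v : Fin n → ℂ) : ℝ := (star v ⬝ᵥ A *ᵥ v).re

/-- The rank one matrix `v v*`. -/
def outer (v : Fin n → ℂ) : Matrix (Fin n) (Fin n) ℂ := vecMulVec v (star v)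

theorem trace_mul_outer (A : Matrix (Fin n) (Fin n) ℂ) (v : Fin n → ℂ) :
    (A * outer v).trace = star v ⬝ᵥ A *ᵥ v := by
  rw [outer, mul_vecMulVec, trace_vecMulVec, dotProduct_comm]

theorem qf_eq_trace (A : Matrix (Fin n) (Fin n) ℂ) (v : Fin n → ℂ) :
    qf A v = (A * outer v).trace.re := by
  rw [trace_mul_outer, qf]

theorem isHermitian_outer (v : Fin n → ℂ) : (outer v).IsHermitian := by
  rw [outer, IsHermitian, conjTranspose_vecMulVec, star_star]

theorem qf_add (A B : Matrix (Fin n) (Fin n) ℂ) (v : Fin n → ℂ) :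
    qf (A + B) v = qf A v + qf B v := by
  simp [qf, add_mulVec, dotProduct_add]

theorem qf_sub (A B : Matrix (Fin n) (Fin n) ℂ) (v : Fin n → ℂ) :
    qf (A - B) v = qf A v - qf B v := by
  simp [qf, sub_mulVec, dotProduct_sub]

theorem qf_smul (c : ℝ) (A : Matrix (Fin n) (Fin n) ℂ) (v : Fin n → ℂ) :
    qf (c • A) v = c * qf A v := by
  simp [qf, smul_mulVec, dotProduct_smul]

theorem qf_one (v : Fin n → ℂ) : qf 1 v = ‖WithLp.toLp 2 v‖ ^ 2 := by
  rw [qf, one_mulVec, dotProduct_comm, ← EuclideanSpace.inner_toLp_toLp]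
  exact (inner_self_eq_norm_sq (𝕜 := ℂ) _)

theorem norm_toLp_mulVec_le (A : Matrix (Fin n) (Fin n) ℂ) (v : Fin n → ℂ) :
    ‖WithLp.toLp 2 (A *ᵥ v)‖ ≤ ‖A‖ * ‖WithLp.toLp 2 v‖ := by
  rw [← frobenius_norm_replicateCol (ι := Unit), ← frobenius_norm_replicateCol (ι := Unit),
    replicateCol_mulVec]
  exact frobenius_norm_mul _ _

theorem abs_qf_le (A : Matrix (Fin n) (Fin n) ℂ) (v : Fin n → ℂ) :
    |qf A v| ≤ ‖A‖ * ‖WithLp.toLp 2 v‖ ^ 2 := by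
  rw [qf, dotProduct_comm, ← EuclideanSpace.inner_toLp_toLp]
  calc _ ≤ ‖inner ℂ (WithLp.toLp 2 v) (WithLp.toLp 2 (A *ᵥ v))‖ := Complex.abs_re_le_norm _
    _ ≤ ‖WithLp.toLp 2 v‖ * ‖WithLp.toLp 2 (A *ᵥ v)‖ := norm_inner_le_norm _ _
    _ ≤ ‖WithLp.toLp 2 v‖ * (‖A‖ * ‖WithLp.toLp 2 v‖) := by
        gcongr; exact norm_toLp_mulVec_le A v
    _ = _ := by ring

theorem frobenius_norm_sq (A : Matrix (Fin n) (Fin n) ℂ) : ‖A‖ ^ 2 = (Aᴴ * A).trace.re := by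
  rw [frobenius_norm_def, ← Real.sqrt_eq_rpow, Real.sq_sqrt (by positivity), trace,
    Finset.sum_comm]
  simp [mul_apply, Complex.sq_norm, Complex.normSq_apply]

theorem norm_outer (v : Fin n → ℂ) : ‖outer v‖ = ‖WithLp.toLp 2 v‖ ^ 2 := by
  have h : ‖outer v‖ ^ 2 = (‖WithLp.toLp 2 v‖ ^ 2) ^ 2 := by
    rw [frobenius_norm_sq, (isHermitian_outer v).eq, trace_mul_outer, outer, vecMulVec_mulVec,
      ← qf_one, qf, one_mulVec]
    have : (star v ⬝ᵥ v).im = 0 := by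
      simp [dotProduct, mul_comm]
    simp [dotProduct_smul, this, sq]
  exact (sq_eq_sq₀ (norm_nonneg _) (by positivity)).1 h

theorem star_dotProduct_eq_qf {A : Matrix (Fin n) (Fin n) ℂ} (hA : A.IsHermitian)
    (v : Fin n → ℂ) : star v ⬝ᵥ A *ᵥ v = (qf A v : ℂ) := by
  apply Complex.ext
  · simp [qf]
  · rw [Complex.ofReal_im]
    have := hA.im_star_dotProduct_mulVec_self v
    simpa using this

theorem qf_pos {A : Matrix (Fin n) (Fin n) ℂ} (hA : A.PosDef) {v : Fin n → ℂ} (hv : v ≠ 0) :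
    0 < qf A v := by
  have := hA.dotProduct_mulVec_pos hv
  rw [star_dotProduct_eq_qf hA.1] at this
  exact_mod_cast this

theorem posDef_of_qf_pos {A : Matrix (Fin n) (Fin n) ℂ} (hA : A.IsHermitian)
    (h : ∀ v, v ≠ 0 → 0 < qf A v) : A.PosDef := by
  refine .of_dotProduct_mulVec_pos hA fun {v} hv => ?_
  rw [star_dotProduct_eq_qf hA]
  exact_mod_cast h v hv

theorem continuous_qf (v : Fin n → ℂ) : Continuous fun A => qf A v := by
  unfold qf; fun_prop

theorem continuous_qf_right (A : Matrix (Fin n) (Fin n) ℂ) : Continuous (qf A) := by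
  unfold qf; fun_prop

theorem continuous_outer : Continuous (outer (n := n)) := by
  unfold outer; fun_prop

theorem qf_conjTranspose_mul_self (B : Matrix (Fin n) (Fin n) ℂ) (v : Fin n → ℂ) :
    qf (Bᴴ * B) v = ‖WithLp.toLp 2 (B *ᵥ v)‖ ^ 2 := by
  rw [← qf_one, qf, qf, one_mulVec, ← mulVec_mulVec, dotProduct_mulVec, star_mulVec]

theorem qf_conj (R A : Matrix (Fin n) (Fin n) ℂ) (v : Fin n → ℂ) :
    qf (Rᴴ * A * R) v = qf A (R *ᵥ v) := by
  rw [qf, qf, mul_assoc, ← mulVec_mulVec, ← mulVec_mulVec, dotProduct_mulVec, star_mulVec]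

theorem outer_mulVec (R : Matrix (Fin n) (Fin n) ℂ) (v : Fin n → ℂ) :
    outer (R *ᵥ v) = R * outer v * Rᴴ := by
  rw [outer, outer, mul_vecMulVec, vecMulVec_mul, star_mulVec]

theorem outer_smul (c : ℝ) (v : Fin n → ℂ) : outer (c • v) = c ^ 2 • outer v := by
  ext i j
  simp [outer, vecMulVec_apply]
  ring

theorem qf_smul_right (A : Matrix (Fin n) (Fin n) ℂ) (c : ℝ) (v : Fin n → ℂ) :
    qf A (c • v) = c ^ 2 * qf A v := by
  rw [qf_eq_trace, outer_smul, qf_eq_trace, mul_smul_comm, trace_smul, Complex.smul_re, smul_eq_mul]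

/-! ### Diagonalisation of positive definite matrices -/

/-- The matrix with eigenvalues `d` and eigenvectors the columns of `U`. -/
def conjDiag (U : Matrix (Fin n) (Fin n) ℂ) (d : Fin n → ℝ) : Matrix (Fin n) (Fin n) ℂ :=
  U * diagonal (fun i => (d i : ℂ)) * Uᴴ

theorem exists_eq_conjDiag {H : Matrix (Fin n) (Fin n) ℂ} (hH : H.PosDef) :
    ∃ U ∈ unitaryGroup (Fin n) ℂ, ∃ d : Fin n → ℝ, (∀ i, 0 < d i) ∧ H = conjDiag U d :=
  ⟨hH.1.eigenvectorUnitary, hH.1.eigenvectorUnitary.2, hH.1.eigenvalues, hH.eigenvalues_pos, by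
    conv_lhs => rw [hH.1.spectral_theorem]
    rfl⟩

theorem qf_conjDiag (U : Matrix (Fin n) (Fin n) ℂ) (d : Fin n → ℝ) (v : Fin n → ℂ) :
    qf (conjDiag U d) v = ∑ i, d i * ‖(Uᴴ *ᵥ v) i‖ ^ 2 := by
  have h : conjDiag U d = Uᴴᴴ * diagonal (fun i => (d i : ℂ)) * Uᴴ := by
    rw [conjTranspose_conjTranspose, conjDiag]
  rw [h, qf_conj, qf]
  simp only [dotProduct, mulVec_diagonal, Complex.re_sum]
  refine Finset.sum_congr rfl fun i _ => ?_
  simp only [Pi.star_apply, RCLike.star_def, Complex.sq_norm, Complex.normSq_apply,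
    Complex.mul_re, Complex.conj_re, Complex.conj_im, Complex.mul_im, Complex.ofReal_re,
    Complex.ofReal_im]
  ring

theorem conjDiag_one {U : Matrix (Fin n) (Fin n) ℂ} (hU : U ∈ unitaryGroup (Fin n) ℂ) :
    conjDiag U 1 = 1 := by
  have := mem_unitaryGroup_iff.1 hU
  rw [star_eq_conjTranspose] at this
  simp [conjDiag, this]

theorem det_conjDiag {U : Matrix (Fin n) (Fin n) ℂ} (hU : U ∈ unitaryGroup (Fin n) ℂ)
    (d : Fin n → ℝ) : (conjDiag U d).det = ((∏ i, d i : ℝ) : ℂ) := by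
  have := mem_unitaryGroup_iff'.1 hU
  rw [star_eq_conjTranspose] at this
  rw [conjDiag, det_mul_comm, ← mul_assoc, this, one_mul, det_diagonal]
  push_cast
  rfl

theorem trace_conjDiag {U : Matrix (Fin n) (Fin n) ℂ} (hU : U ∈ unitaryGroup (Fin n) ℂ)
    (d : Fin n → ℝ) : (conjDiag U d).trace = ((∑ i, d i : ℝ) : ℂ) := by
  have := mem_unitaryGroup_iff'.1 hU
  rw [star_eq_conjTranspose] at this
  rw [conjDiag, trace_mul_comm, ← mul_assoc, this, one_mul, trace_diagonal]
  push_cast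
  rfl

theorem sum_norm_sq_conjTranspose_mulVec {U : Matrix (Fin n) (Fin n) ℂ}
    (hU : U ∈ unitaryGroup (Fin n) ℂ) (v : Fin n → ℂ) :
    ∑ i, ‖(Uᴴ *ᵥ v) i‖ ^ 2 = ‖WithLp.toLp 2 v‖ ^ 2 := by
  rw [← qf_one, ← conjDiag_one hU, qf_conjDiag]
  simp

theorem posDef_conjDiag {U : Matrix (Fin n) (Fin n) ℂ} (hU : U ∈ unitaryGroup (Fin n) ℂ)
    {d : Fin n → ℝ} (hd : ∀ i, 0 < d i) : (conjDiag U d).PosDef := by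
  have h := mem_unitaryGroup_iff.1 hU
  rw [star_eq_conjTranspose] at h
  refine (PosDef.diagonal fun i => ?_).mul_mul_conjTranspose_same ?_
  · exact_mod_cast hd i
  · exact vecMul_injective_of_isUnit (IsUnit.of_mul_eq_one _ h)

/-- A positive definite matrix has the form `B* B` with `B` invertible. -/
theorem exists_eq_conjTranspose_mul_self {H : Matrix (Fin n) (Fin n) ℂ} (hH : H.PosDef) :
    ∃ B : Matrix (Fin n) (Fin n) ℂ, IsUnit B.det ∧ H = Bᴴ * B := by
  obtain ⟨U, hU, d, hd, rfl⟩ := exists_eq_conjDiag hH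
  have h : conjDiag U d = (diagonal (fun i => (Real.sqrt (d i) : ℂ)) * Uᴴ)ᴴ *
      (diagonal (fun i => (Real.sqrt (d i) : ℂ)) * Uᴴ) := by
    rw [conjTranspose_mul, conjTranspose_conjTranspose, diagonal_conjTranspose, conjDiag,
      mul_assoc, mul_assoc, ← mul_assoc (diagonal _) (diagonal _), diagonal_mul_diagonal]
    congr 3
    ext i
    simp [← Complex.ofReal_mul, Real.mul_self_sqrt (hd i).le]
  refine ⟨_, ?_, h⟩
  have hu := hH.isUnit
  rw [isUnit_iff_isUnit_det, h, det_mul] at hu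
  exact isUnit_of_mul_isUnit_right hu

theorem exists_mul_norm_sq_le_qf {H : Matrix (Fin n) (Fin n) ℂ} (hH : H.PosDef) :
    ∃ c > 0, ∀ v : Fin n → ℂ, c * ‖WithLp.toLp 2 v‖ ^ 2 ≤ qf H v := by
  obtain ⟨B, hB, rfl⟩ := exists_eq_conjTranspose_mul_self hH
  refine ⟨((‖B⁻¹‖ + 1) ^ 2)⁻¹, by positivity, fun v => ?_⟩
  have h := norm_toLp_mulVec_le B⁻¹ (B *ᵥ v)
  rw [mulVec_mulVec, nonsing_inv_mul _ hB, one_mulVec] at h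
  rw [qf_conjTranspose_mul_self, inv_mul_le_iff₀ (by positivity), ← mul_pow]
  gcongr
  refine h.trans ?_
  gcongr
  linarith

theorem ne_zero_of_unit {v : Fin n → ℂ} (hv : ‖WithLp.toLp 2 v‖ = 1) : v ≠ 0 := by
  rintro rfl; simp at hv

/-! ### Stable families of unit vectors -/

/-- A measurable family `z` of unit vectors of `ℂ^n` over a probability space, such that every
proper non-zero subspace `W` contains `z x` with probability less than `dim W / n`. -/
structure StableFrame (μ : Measure X) (z : X → Fin n → ℂ) : Prop where
  prob : IsProbabilityMeasure μ
  measurable : Measurable z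
  unit : ∀ x, ‖WithLp.toLp 2 (z x)‖ = 1
  stable : ∀ W : Submodule ℂ (Fin n → ℂ), W ≠ ⊥ → W ≠ ⊤ →
    μ.real {x | z x ∈ W} < (Module.finrank ℂ W : ℝ) / n

/-- Donaldson's map of a family of unit vectors. -/
def frameMap (μ : Measure X) (z : X → Fin n → ℂ) (G : Matrix (Fin n) (Fin n) ℂ) :
    Matrix (Fin n) (Fin n) ℂ :=
  (n : ℝ) • ∫ x, (qf G⁻¹ (z x))⁻¹ • outer (z x) ∂μ

namespace StableFrame

variable {μ : Measure X} {z : X → Fin n → ℂ} (hz : StableFrame μ z)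
include hz

theorem ne_zero (x : X) : z x ≠ 0 := ne_zero_of_unit (hz.unit x)

theorem qf_one (x : X) : qf 1 (z x) = 1 := by rw [Donaldson.qf_one, hz.unit, one_pow]

theorem nonempty : Nonempty X := by
  have := hz.prob
  exact μ.nonempty_of_neZero

theorem pos : 0 < n := by
  obtain ⟨x⟩ := hz.nonempty
  rcases Nat.eq_zero_or_pos n with rfl | h
  · exact absurd (Subsingleton.elim _ _) (hz.ne_zero x)
  · exact h

theorem measurable_qf (A : Matrix (Fin n) (Fin n) ℂ) : Measurable fun x => qf A (z x) :=
  (continuous_qf_right A).measurable.comp hz.measurable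

theorem abs_qf_le (A : Matrix (Fin n) (Fin n) ℂ) (x : X) : |qf A (z x)| ≤ ‖A‖ := by
  simpa [hz.unit] using Donaldson.abs_qf_le A (z x)

theorem integrable_qf (A : Matrix (Fin n) (Fin n) ℂ) : Integrable (fun x => qf A (z x)) μ := by
  have := hz.prob
  exact Integrable.of_bound (hz.measurable_qf A).aestronglyMeasurable ‖A‖
    (.of_forall fun x => hz.abs_qf_le A x)

theorem integrable_mul_qf {w : X → ℝ} (hw : Integrable w μ) (A : Matrix (Fin n) (Fin n) ℂ) :
    Integrable (fun x => w x * qf A (z x)) μ :=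
  hw.mul_bdd (c := ‖A‖) (hz.measurable_qf A).aestronglyMeasurable
    (.of_forall fun x => hz.abs_qf_le A x)

theorem norm_outer (x : X) : ‖outer (z x)‖ = 1 := by
  rw [Donaldson.norm_outer, hz.unit, one_pow]

theorem integrable_smul_outer {w : X → ℝ} (hw : Integrable w μ) :
    Integrable (fun x => w x • outer (z x)) μ := by
  refine hw.mono ?_ (.of_forall fun x => ?_)
  · exact hw.aestronglyMeasurable.smul
      (continuous_outer.comp_aestronglyMeasurable hz.measurable.aestronglyMeasurable)
  · rw [norm_smul, hz.norm_outer, mul_one]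

theorem trace_mul_integral {w : X → ℝ} (hw : Integrable w μ) (A : Matrix (Fin n) (Fin n) ℂ) :
    (A * ∫ x, w x • outer (z x) ∂μ).trace.re = ∫ x, w x * qf A (z x) ∂μ := by
  let φ : Matrix (Fin n) (Fin n) ℂ →ₗ[ℝ] ℝ :=
    { toFun := fun M => (A * M).trace.re
      map_add' := fun M N => by simp [mul_add]
      map_smul' := fun c M => by simp }
  have h := (LinearMap.toContinuousLinearMap φ).integral_comp_comm (hz.integrable_smul_outer hw)
  have h2 : ∀ x, LinearMap.toContinuousLinearMap φ (w x • outer (z x)) = w x * qf A (z x) := by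
    intro x
    simp [φ, qf_eq_trace]
  simp only [h2] at h
  exact h.symm

theorem isHermitian_integral {w : X → ℝ} (hw : Integrable w μ) :
    (∫ x, w x • outer (z x) ∂μ).IsHermitian := by
  let φ : Matrix (Fin n) (Fin n) ℂ →ₗ[ℝ] Matrix (Fin n) (Fin n) ℂ :=
    { toFun := fun M => Mᴴ
      map_add' := fun M N => by simp
      map_smul' := fun c M => by simp }
  have h := (LinearMap.toContinuousLinearMap φ).integral_comp_comm (hz.integrable_smul_outer hw)
  have h2 : ∀ x, LinearMap.toContinuousLinearMap φ (w x • outer (z x)) = w x • outer (z x) := by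
    intro x
    simp [φ, (isHermitian_outer (z x)).eq]
  simp only [h2] at h
  exact h.symm

theorem norm_integral_le (w : X → ℝ) : ‖∫ x, w x • outer (z x) ∂μ‖ ≤ ∫ x, |w x| ∂μ := by
  refine (norm_integral_le_integral_norm _).trans (le_of_eq ?_)
  simp only [norm_smul, hz.norm_outer, mul_one, Real.norm_eq_abs]

omit hz in
theorem qf_outer (u v : Fin n → ℂ) : qf (outer u) v = ‖star u ⬝ᵥ v‖ ^ 2 := by
  rw [qf, outer, vecMulVec_mulVec]
  have : star v ⬝ᵥ u = star (star u ⬝ᵥ v) := by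
    rw [← star_dotProduct]
  simp [dotProduct_smul, this, Complex.sq_norm, Complex.normSq_apply]

theorem integrable_inv_qf {H : Matrix (Fin n) (Fin n) ℂ} (hH : H.PosDef) :
    Integrable (fun x => (qf H (z x))⁻¹) μ := by
  have := hz.prob
  obtain ⟨c, hc, h⟩ := exists_mul_norm_sq_le_qf hH
  refine Integrable.of_bound (hz.measurable_qf H).inv.aestronglyMeasurable c⁻¹
    (.of_forall fun x => ?_)
  have hx := h (z x)
  rw [hz.unit, one_pow, mul_one] at hx
  rw [norm_inv, Real.norm_eq_abs, abs_of_pos (hc.trans_le hx)]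
  gcongr

theorem isHermitian_frameMap {G : Matrix (Fin n) (Fin n) ℂ} (hG : G.PosDef) :
    (frameMap μ z G).IsHermitian := by
  have h := hz.isHermitian_integral (hz.integrable_inv_qf hG.inv)
  rw [frameMap, IsHermitian, conjTranspose_smul, h.eq]
  simp

theorem trace_mul_frameMap {G : Matrix (Fin n) (Fin n) ℂ} (hG : G.PosDef)
    (A : Matrix (Fin n) (Fin n) ℂ) :
    (A * frameMap μ z G).trace.re = n * ∫ x, (qf G⁻¹ (z x))⁻¹ * qf A (z x) ∂μ := by
  rw [← hz.trace_mul_integral (hz.integrable_inv_qf hG.inv), frameMap]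
  simp

theorem qf_frameMap {G : Matrix (Fin n) (Fin n) ℂ} (hG : G.PosDef) (v : Fin n → ℂ) :
    qf (frameMap μ z G) v = n * ∫ x, (qf G⁻¹ (z x))⁻¹ * qf (outer v) (z x) ∂μ := by
  rw [qf_eq_trace, trace_mul_comm, hz.trace_mul_frameMap hG]

/-- The family is not contained almost surely in a proper subspace. -/
theorem not_ae_mem {W : Submodule ℂ (Fin n → ℂ)} (hW : W ≠ ⊤) : ¬ ∀ᵐ x ∂μ, z x ∈ W := by
  have := hz.prob
  intro h
  have h1 : μ.real {x | z x ∈ W} = 1 := by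
    rw [measureReal_def, (mem_ae_iff_prob_eq_one₀ ?_).1 h]
    · simp
    · exact (hz.measurable (W.closed_of_finiteDimensional.measurableSet)).nullMeasurableSet
  rcases eq_or_ne W ⊥ with rfl | hb
  · obtain ⟨x, hx⟩ := h.exists
    exact hz.ne_zero x (by simpa using hx)
  · have h2 := hz.stable W hb hW
    rw [h1, lt_div_iff₀ (by exact_mod_cast hz.pos), one_mul] at h2
    have h3 := Submodule.finrank_le W
    rw [Module.finrank_fin_fun] at h3
    exact absurd h2 (not_lt.2 (by exact_mod_cast h3))

theorem posDef_frameMap {G : Matrix (Fin n) (Fin n) ℂ} (hG : G.PosDef) :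
    (frameMap μ z G).PosDef := by
  refine posDef_of_qf_pos (hz.isHermitian_frameMap hG) fun v hv => ?_
  rw [hz.qf_frameMap hG]
  have hn : (0 : ℝ) < n := by exact_mod_cast hz.pos
  refine mul_pos hn ?_
  have hpos : ∀ x, 0 < qf G⁻¹ (z x) := fun x => qf_pos hG.inv (hz.ne_zero x)
  have h0 : ∀ x, 0 ≤ (qf G⁻¹ (z x))⁻¹ * qf (outer v) (z x) := fun x =>
    mul_nonneg (inv_nonneg.2 (hpos x).le) (by rw [qf_outer]; positivity)
  refine lt_of_le_of_ne (integral_nonneg h0) fun h => ?_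
  rw [eq_comm, integral_eq_zero_iff_of_nonneg h0
    (hz.integrable_mul_qf (hz.integrable_inv_qf hG.inv) _)] at h
  let φ : (Fin n → ℂ) →ₗ[ℂ] ℂ := dotProductBilin ℂ ℂ (star v)
  refine hz.not_ae_mem (W := LinearMap.ker φ) (fun ht => hv ?_) ?_
  · have : φ v = 0 := by rw [LinearMap.ker_eq_top.1 ht]; rfl
    exact dotProduct_star_self_eq_zero.1 (by simpa [φ, dotProduct_comm] using this)
  · filter_upwards [h] with x hx
    rw [LinearMap.mem_ker]
    have hx' : (qf G⁻¹ (z x))⁻¹ * qf (outer v) (z x) = 0 := hx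
    rw [qf_outer] at hx'
    simpa [(hpos x).ne', φ] using hx'

end StableFrame

/-! ### The linearisation at a balanced matrix and its spectral gap -/

theorem norm_sq_mulVec_sub {A : Matrix (Fin n) (Fin n) ℂ} (hA : A.IsHermitian) (c : ℝ)
    (v : Fin n → ℂ) : ‖WithLp.toLp 2 (A *ᵥ v - c • v)‖ ^ 2 =
      qf (Aᴴ * A) v - 2 * c * qf A v + c ^ 2 * qf 1 v := by
  have h : A *ᵥ v - c • v = (A - c • (1 : Matrix (Fin n) (Fin n) ℂ)) *ᵥ v := by
    rw [sub_mulVec, smul_mulVec, one_mulVec]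
  have h2 : (A - c • (1 : Matrix (Fin n) (Fin n) ℂ))ᴴ * (A - c • (1 : Matrix (Fin n) (Fin n) ℂ)) =
      Aᴴ * A - (2 * c) • A + (c ^ 2) • (1 : Matrix (Fin n) (Fin n) ℂ) := by
    rw [conjTranspose_sub, conjTranspose_smul, conjTranspose_one, hA.eq]
    simp only [star_trivial, sub_mul, mul_sub, smul_mul_assoc, mul_smul_comm, one_mul, mul_one]
    module
  rw [h, ← qf_conjTranspose_mul_self, h2, qf_add, qf_sub, qf_smul, qf_smul]

namespace StableFrame

variable {μ : Measure X} {z : X → Fin n → ℂ} (hz : StableFrame μ z)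
include hz

theorem sq_qf_le {A : Matrix (Fin n) (Fin n) ℂ} (hA : A.IsHermitian) (x : X) :
    qf A (z x) ^ 2 ≤ qf (Aᴴ * A) (z x) := by
  have h := norm_sq_mulVec_sub hA (qf A (z x)) (z x)
  rw [hz.qf_one] at h
  nlinarith [sq_nonneg ‖WithLp.toLp 2 (A *ᵥ z x - qf A (z x) • z x)‖]

theorem mulVec_eq_of_sq_qf_eq {A : Matrix (Fin n) (Fin n) ℂ} (hA : A.IsHermitian) {x : X}
    (h : qf A (z x) ^ 2 = qf (Aᴴ * A) (z x)) : A *ᵥ z x = qf A (z x) • z x := by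
  have h1 := norm_sq_mulVec_sub hA (qf A (z x)) (z x)
  rw [hz.qf_one, ← h] at h1
  have h2 : ‖WithLp.toLp 2 (A *ᵥ z x - qf A (z x) • z x)‖ = 0 := by
    rw [← sq_eq_zero_iff, h1]; ring
  exact sub_eq_zero.1 (congrArg WithLp.ofLp (norm_eq_zero.1 h2))

/-- If almost every vector of the family is an eigenvector of `A`, then `A` is scalar. -/
theorem eq_smul_one_of_ae_eigenvector {A : Matrix (Fin n) (Fin n) ℂ} (hA : A.IsHermitian)
    (h : ∀ᵐ x ∂μ, A *ᵥ z x = qf A (z x) • z x) : ∃ c : ℝ, A = c • 1 := by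
  have := hz.prob
  have hn : (0 : ℝ) < n := by exact_mod_cast hz.pos
  let i : Fin n := ⟨0, hz.pos⟩
  set c := hA.eigenvalues i
  refine ⟨c, ?_⟩
  let f : (Fin n → ℂ) →ₗ[ℂ] (Fin n → ℂ) := mulVecLin (A - c • 1)
  have hf : ∀ v, f v = A *ᵥ v - c • v := fun v => by
    simp [f]
  have hker : LinearMap.ker f ≠ ⊥ := by
    intro hb
    have h1 := hA.mulVec_eigenvectorBasis i
    have h2 : ⇑(hA.eigenvectorBasis i) ∈ LinearMap.ker f := by
      rw [LinearMap.mem_ker, hf, h1]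
      exact sub_self _
    rw [hb, Submodule.mem_bot] at h2
    have h3 := hA.eigenvectorBasis.orthonormal.ne_zero i
    exact h3 (by ext j; exact congrFun h2 j)
  by_contra hne
  have hf0 : f ≠ 0 := by
    intro h0
    apply hne
    rw [← sub_eq_zero]
    exact (Matrix.toLin' (R := ℂ) (m := Fin n) (n := Fin n)).injective (h0.trans (map_zero _).symm)
  have hkt : LinearMap.ker f ≠ ⊤ := fun ht => hf0 (LinearMap.ker_eq_top.1 ht)
  have hrb : LinearMap.range f ≠ ⊥ := fun hb => hf0 (LinearMap.range_eq_bot.1 hb)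
  have hrt : LinearMap.range f ≠ ⊤ := fun ht => hker (LinearMap.ker_eq_bot_iff_range_eq_top.2 ht)
  have h1 := hz.stable _ hker hkt
  have h2 := hz.stable _ hrb hrt
  have h3 := LinearMap.finrank_range_add_finrank_ker f
  rw [Module.finrank_fin_fun] at h3
  have h4 : (1 : ℝ) ≤ μ.real {x | z x ∈ LinearMap.ker f} + μ.real {x | z x ∈ LinearMap.range f} := by
    rw [← probReal_univ (μ := μ)]
    refine le_trans ?_ (measureReal_union_le _ _)
    rw [measureReal_def, measureReal_def]
    refine ENNReal.toReal_mono (measure_ne_top _ _) (measure_mono_ae ?_)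
    filter_upwards [h] with x hx _
    by_cases hc : qf A (z x) = c
    · left
      change f (z x) = 0
      rw [hf, hx, hc, sub_self]
    · right
      refine ⟨(qf A (z x) - c)⁻¹ • z x, ?_⟩
      rw [hf, mulVec_smul, hx, smul_comm c, ← smul_sub, ← sub_smul, smul_smul,
        inv_mul_cancel₀ (sub_ne_zero.2 hc), one_smul]
  have h5 : (Module.finrank ℂ (LinearMap.ker f) : ℝ) / n +
      (Module.finrank ℂ (LinearMap.range f) : ℝ) / n = 1 := by
    rw [← add_div, div_eq_one_iff_eq hn.ne', add_comm]
    exact_mod_cast h3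
  linarith

theorem integral_qf_of_balanced (hb : frameMap μ z 1 = 1) (A : Matrix (Fin n) (Fin n) ℂ) :
    n * ∫ x, qf A (z x) ∂μ = A.trace.re := by
  have h := hz.trace_mul_frameMap PosDef.one A
  rw [hb, mul_one, inv_one] at h
  simpa [hz.qf_one] using h.symm

theorem integrable_sq_qf (A : Matrix (Fin n) (Fin n) ℂ) :
    Integrable (fun x => qf A (z x) ^ 2) μ := by
  simpa only [sq] using hz.integrable_mul_qf (hz.integrable_qf A) A

theorem integral_sq_qf_le (hb : frameMap μ z 1 = 1) {A : Matrix (Fin n) (Fin n) ℂ}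
    (hA : A.IsHermitian) : n * ∫ x, qf A (z x) ^ 2 ∂μ ≤ ‖A‖ ^ 2 := by
  rw [frobenius_norm_sq, ← hz.integral_qf_of_balanced hb]
  gcongr ?_ * ?_
  exact integral_mono (hz.integrable_sq_qf A) (hz.integrable_qf _) (hz.sq_qf_le hA)

theorem integral_sq_qf_lt (hb : frameMap μ z 1 = 1) {A : Matrix (Fin n) (Fin n) ℂ}
    (hA : A.IsHermitian) (htr : A.trace.re = 0) (h0 : A ≠ 0) :
    n * ∫ x, qf A (z x) ^ 2 ∂μ < ‖A‖ ^ 2 := by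
  have hn : (0 : ℝ) < n := by exact_mod_cast hz.pos
  refine lt_of_le_of_ne (hz.integral_sq_qf_le hb hA) fun h => h0 ?_
  rw [frobenius_norm_sq, ← hz.integral_qf_of_balanced hb] at h
  have h1 : ∫ x, (qf (Aᴴ * A) (z x) - qf A (z x) ^ 2) ∂μ = 0 := by
    rw [integral_sub (hz.integrable_qf _) (hz.integrable_sq_qf A), mul_left_cancel₀ hn.ne' h,
      sub_self]
  rw [integral_eq_zero_iff_of_nonneg (fun x => sub_nonneg.2 (hz.sq_qf_le hA x))
    ((hz.integrable_qf _).sub (hz.integrable_sq_qf A))] at h1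
  obtain ⟨c, rfl⟩ := hz.eq_smul_one_of_ae_eigenvector hA (by
    filter_upwards [h1] with x hx
    exact hz.mulVec_eq_of_sq_qf_eq hA (sub_eq_zero.1 hx).symm)
  have : c = 0 := by
    simpa [hz.pos.ne'] using htr
  simp [this]

/-- A bound for the linearisation `A ↦ n ∫ ⟨A z, z⟩ z z*` of `frameMap` at the identity. -/
theorem norm_sq_linearisation_le (hb : frameMap μ z 1 = 1) (A : Matrix (Fin n) (Fin n) ℂ) :
    ‖(n : ℝ) • ∫ x, qf A (z x) • outer (z x) ∂μ‖ ^ 2 ≤ n * ∫ x, qf A (z x) ^ 2 ∂μ := by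
  set M := (n : ℝ) • ∫ x, qf A (z x) • outer (z x) ∂μ with hM
  have hMH : M.IsHermitian := by
    have h := hz.isHermitian_integral (hz.integrable_qf A)
    rw [hM, IsHermitian, conjTranspose_smul, h.eq]
    simp
  have h1 : ‖M‖ ^ 2 = n * ∫ x, qf A (z x) * qf M (z x) ∂μ := by
    rw [frobenius_norm_sq, hMH.eq, ← hz.trace_mul_integral (hz.integrable_qf A)]
    conv_lhs => rw [hM, mul_smul_comm, trace_smul, Complex.smul_re, smul_eq_mul]
  have h2 := hz.integral_sq_qf_le hb hMH
  have h3 : ∫ x, qf A (z x) * qf M (z x) ∂μ ≤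
      (∫ x, qf A (z x) ^ 2 ∂μ + ∫ x, qf M (z x) ^ 2 ∂μ) / 2 := by
    rw [← integral_add (hz.integrable_sq_qf A) (hz.integrable_sq_qf M), ← integral_div]
    refine integral_mono (hz.integrable_mul_qf (hz.integrable_qf A) M)
      (((hz.integrable_sq_qf A).add (hz.integrable_sq_qf M)).div_const 2) fun x => ?_
    dsimp only
    nlinarith [sq_nonneg (qf A (z x) - qf M (z x))]
  have h4 := mul_le_mul_of_nonneg_left h3 (Nat.cast_nonneg (α := ℝ) n)
  linarith

theorem continuousOn_integral_sq_qf :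
    ContinuousOn (fun A => (n : ℝ) * ∫ x, qf A (z x) ^ 2 ∂μ)
      (Metric.closedBall (0 : Matrix (Fin n) (Fin n) ℂ) 1) := by
  have := hz.prob
  refine continuousOn_const.mul (continuousOn_of_dominated (bound := fun _ => 1) ?_ ?_ ?_ ?_)
  · exact fun A _ => (hz.integrable_sq_qf A).aestronglyMeasurable
  · refine fun A hA => .of_forall fun x => ?_
    rw [mem_closedBall_zero_iff] at hA
    have := (hz.abs_qf_le A x).trans hA
    rw [norm_pow, Real.norm_eq_abs]
    exact pow_le_one₀ (abs_nonneg _) this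
  · exact integrable_const _
  · exact .of_forall fun x => ((continuous_qf (z x)).pow 2).continuousOn

/-- The spectral gap of the linearisation on trace free Hermitian matrices. -/
theorem exists_spectral_gap (hb : frameMap μ z 1 = 1) :
    ∃ β : ℝ, 0 ≤ β ∧ β < 1 ∧ ∀ A : Matrix (Fin n) (Fin n) ℂ, A.IsHermitian → A.trace.re = 0 →
      ‖(n : ℝ) • ∫ x, qf A (z x) • outer (z x) ∂μ‖ ≤ β * ‖A‖ := by
  let S : Set (Matrix (Fin n) (Fin n) ℂ) :=
    Metric.sphere 0 1 ∩ {A | A.IsHermitian ∧ A.trace.re = 0}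
  have hS : IsCompact S := by
    refine (isCompact_sphere 0 1).inter_right (IsClosed.inter ?_ ?_)
    · exact isClosed_eq continuous_star continuous_id
    · refine isClosed_eq (f := fun A : Matrix (Fin n) (Fin n) ℂ => A.trace.re) ?_ continuous_const
      exact Complex.continuous_re.comp
        (LinearMap.continuous_of_finiteDimensional (traceLinearMap (Fin n) ℂ ℂ))
  obtain ⟨m, hm0, hm1, hm⟩ : ∃ m : ℝ, 0 ≤ m ∧ m < 1 ∧
      ∀ A ∈ S, (n : ℝ) * ∫ x, qf A (z x) ^ 2 ∂μ ≤ m := by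
    rcases S.eq_empty_or_nonempty with he | hne
    · exact ⟨0, le_rfl, one_pos, by simp [he]⟩
    · obtain ⟨A, hAS, hA⟩ := hS.exists_isMaxOn hne
        (hz.continuousOn_integral_sq_qf.mono
          (Set.inter_subset_left.trans Metric.sphere_subset_closedBall))
      have hA1 : ‖A‖ = 1 := by simpa using hAS.1
      refine ⟨_, ?_, ?_, fun B hB => hA hB⟩
      · have : 0 ≤ ∫ x, qf A (z x) ^ 2 ∂μ := integral_nonneg fun x => sq_nonneg _
        positivity
      · have := hz.integral_sq_qf_lt hb hAS.2.1 hAS.2.2 (by rintro rfl; simp at hA1)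
        simpa [hA1] using this
  refine ⟨Real.sqrt m, Real.sqrt_nonneg _, by rw [Real.sqrt_lt' one_pos]; simpa, ?_⟩
  intro A hA htr
  rcases eq_or_ne A 0 with rfl | h0
  · simp [qf]
  have hpos : 0 < ‖A‖ := norm_pos_iff.2 h0
  have h1 := hm (‖A‖⁻¹ • A) ⟨by simp [norm_smul, hpos.ne'], by
    rw [IsHermitian, conjTranspose_smul, hA.eq]; simp, by simp [htr]⟩
  simp only [qf_smul, mul_pow, integral_const_mul] at h1
  have h2 : n * ∫ x, qf A (z x) ^ 2 ∂μ ≤ m * ‖A‖ ^ 2 := by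
    rw [inv_pow, mul_left_comm, inv_mul_le_iff₀ (by positivity)] at h1
    linarith
  refine (sq_le_sq₀ (norm_nonneg _) (by positivity)).1 ?_
  rw [mul_pow, Real.sq_sqrt hm0]
  exact (hz.norm_sq_linearisation_le hb A).trans h2

end StableFrame

/-! ### Exponential convergence when the identity is a fixed point -/

theorem exists_geometric_bound {e τ : ℕ → ℝ} {β K : ℝ} (hβ0 : 0 ≤ β) (hβ1 : β < 1)
    (he : ∀ s, 0 ≤ e s) (hτ : ∀ s, 0 ≤ τ s) (hanti : ∀ s, τ (s + 1) ≤ τ s)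
    (hrec : ∀ s, e (s + 1) ≤ β * e s + 2 * (τ s - τ (s + 1)))
    (hquad : ∀ s, τ s - τ (s + 1) ≤ K * e s ^ 2) :
    ∃ τ' C γ : ℝ, 0 < C ∧ 0 < γ ∧ γ < 1 ∧ Tendsto τ atTop (𝓝 τ') ∧
      ∀ s, e s ≤ C * γ ^ s ∧ |τ s - τ'| ≤ C * γ ^ s := by
  have hτanti : Antitone τ := antitone_nat_of_succ_le hanti
  have hbdd : BddBelow (Set.range τ) := ⟨0, by rintro _ ⟨s, rfl⟩; exact hτ s⟩
  have hlim := tendsto_atTop_ciInf hτanti hbdd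
  set τ' := ⨅ s, τ s
  have hτ'0 : 0 ≤ τ' := le_ciInf hτ
  have hge : ∀ s, τ' ≤ τ s := fun s => ciInf_le hbdd s
  have hφanti : Antitone fun s => e s + 2 * τ s := antitone_nat_of_succ_le fun s => by
    nlinarith [hrec s, he s]
  have hφlim := tendsto_atTop_ciInf hφanti ⟨0, by
    rintro _ ⟨s, rfl⟩; exact add_nonneg (he s) (mul_nonneg zero_le_two (hτ s))⟩
  have helim : Tendsto e atTop (𝓝 0) := by
    have h := (hφlim.sub ((tendsto_add_atTop_iff_nat 1).2 hφlim)).div_const (1 - β)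
    rw [sub_self, zero_div] at h
    refine squeeze_zero he (fun s => ?_) h
    rw [le_div_iff₀ (by linarith)]
    have := hrec s
    nlinarith
  set γ := (1 + β) / 2 with hγ
  have hγ0 : 0 < γ := by rw [hγ]; linarith
  have hγ1 : γ < 1 := by rw [hγ]; linarith
  have hKe : Tendsto (fun s => 4 * (K * e s)) atTop (𝓝 0) := by
    simpa using (helim.const_mul K).const_mul 4
  obtain ⟨N, hN⟩ := eventually_atTop.1 (hKe.eventually (ge_mem_nhds (sub_pos.2 hβ1)))
  have hstep : ∀ s, N ≤ s → τ s - τ (s + 1) ≤ e s ∧ e (s + 1) ≤ γ * e s := by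
    intro s hs
    have h1 := hN s hs
    have h2 := hquad s
    have h3 := hrec s
    have h4 : 4 * (K * e s ^ 2) ≤ (1 - β) * e s := by nlinarith [he s]
    constructor
    · nlinarith [he s]
    · rw [hγ]; linarith
  have hpow : ∀ k, e (N + k) ≤ e N * γ ^ k := by
    intro k
    induction k with
    | zero => simp
    | succ k ih =>
      rw [pow_succ, ← add_assoc]
      nlinarith [(hstep (N + k) (Nat.le_add_right _ _)).2]
  have hτe : ∀ s, N ≤ s → τ s - τ' ≤ e s / (1 - γ) := by
    intro s hs
    have hmono : Monotone fun k => τ (s + k) - e (s + k) / (1 - γ) := by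
      refine monotone_nat_of_le_succ fun k => ?_
      obtain ⟨h1, h2⟩ := hstep (s + k) (hs.trans (Nat.le_add_right _ _))
      have h3 : e (s + k) ≤ (e (s + k) - e (s + (k + 1))) / (1 - γ) := by
        rw [le_div_iff₀ (by linarith), ← add_assoc]; linarith
      rw [sub_div] at h3
      rw [← add_assoc] at h3 ⊢
      linarith
    have h1 : Tendsto (fun k => τ (s + k) - e (s + k) / (1 - γ)) atTop (𝓝 (τ' - 0 / (1 - γ))) := by
      have ht : Tendsto (fun k => s + k) atTop atTop := tendsto_atTop_mono (fun k => Nat.le_add_left k s) tendsto_id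
      exact (hlim.comp ht).sub ((helim.comp ht).div_const _)
    have h2 := hmono.ge_of_tendsto h1 0
    simp only [add_zero, zero_div, sub_zero] at h2
    linarith
  set B := e 0 + 2 * τ 0 + 1
  have hB : 0 < B := by have := he 0; have := hτ 0; positivity
  have h1γ : 0 < 1 - γ := by linarith
  have heB : ∀ s, e s ≤ B := fun s => by
    have h := hφanti (Nat.zero_le s)
    dsimp only at h
    have := hτ s
    change e s ≤ e 0 + 2 * τ 0 + 1
    linarith
  have hτB : ∀ s, τ s - τ' ≤ B := fun s => by
    have h := hτanti (Nat.zero_le s)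
    have := he 0
    have := hτ 0
    change τ s - τ' ≤ e 0 + 2 * τ 0 + 1
    linarith
  have hdiv : ∀ t : ℝ, 0 ≤ t → t ≤ t / (1 - γ) := fun t ht => by
    rw [le_div_iff₀ h1γ]; nlinarith
  refine ⟨τ', B / (1 - γ) / γ ^ N, γ, by positivity, hγ0, hγ1, hlim, fun s => ?_⟩
  rw [abs_of_nonneg (sub_nonneg.2 (hge s))]
  rcases le_total N s with hs | hs
  · obtain ⟨k, rfl⟩ := Nat.exists_eq_add_of_le hs
    have h1 : e (N + k) / (1 - γ) ≤ B / (1 - γ) / γ ^ N * γ ^ (N + k) := by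
      rw [pow_add, ← mul_assoc, div_mul_cancel₀ _ (by positivity), div_mul_eq_mul_div]
      gcongr
      exact (hpow k).trans (by gcongr; exact heB N)
    exact ⟨(hdiv _ (he _)).trans h1, (hτe _ hs).trans h1⟩
  · have h1 : B ≤ B / (1 - γ) / γ ^ N * γ ^ s := by
      rw [div_mul_eq_mul_div, le_div_iff₀ (by positivity)]
      gcongr ?_ * ?_
      · exact hdiv _ hB.le
      · exact pow_le_pow_of_le_one hγ0.le hγ1.le hs
    exact ⟨(heB s).trans h1, (hτB s).trans h1⟩

theorem mul_qf_inv_le {G : Matrix (Fin n) (Fin n) ℂ} (hG : G.PosDef) {l : ℝ} (hl : 0 ≤ l)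
    (h : ∀ v, l * ‖WithLp.toLp 2 v‖ ^ 2 ≤ qf G v) (v : Fin n → ℂ) :
    l * qf G⁻¹ v ≤ ‖WithLp.toLp 2 v‖ ^ 2 := by
  have hu : IsUnit G.det := (isUnit_iff_isUnit_det _).1 hG.isUnit
  have h1 := norm_sq_mulVec_sub hG.1 l (G⁻¹ *ᵥ v)
  have h2 : qf G (G⁻¹ *ᵥ v) = qf G⁻¹ v := by
    rw [← qf_conj, hG.inv.1.eq, nonsing_inv_mul _ hu, one_mul]
  have h3 : qf (Gᴴ * G) (G⁻¹ *ᵥ v) = ‖WithLp.toLp 2 v‖ ^ 2 := by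
    rw [qf_conjTranspose_mul_self, mulVec_mulVec, mul_nonsing_inv _ hu, one_mulVec]
  have h4 := h (G⁻¹ *ᵥ v)
  rw [h2, h3, qf_one] at h1
  rw [h2] at h4
  nlinarith [sq_nonneg ‖WithLp.toLp 2 (G *ᵥ G⁻¹ *ᵥ v - l • G⁻¹ *ᵥ v)‖]

theorem qf_inv_mulVec_sub {G : Matrix (Fin n) (Fin n) ℂ} (hG : G.PosDef) (a : ℝ)
    (v : Fin n → ℂ) :
    qf G⁻¹ (G *ᵥ v - a • v) = qf G v - 2 * a * qf 1 v + a ^ 2 * qf G⁻¹ v := by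
  have hu : IsUnit G.det := (isUnit_iff_isUnit_det _).1 hG.isUnit
  have h : G *ᵥ v - a • v = (G - a • (1 : Matrix (Fin n) (Fin n) ℂ)) *ᵥ v := by
    rw [sub_mulVec, smul_mulVec, one_mulVec]
  have h2 : (G - a • (1 : Matrix (Fin n) (Fin n) ℂ))ᴴ * G⁻¹ *
      (G - a • (1 : Matrix (Fin n) (Fin n) ℂ)) =
      G - (2 * a) • (1 : Matrix (Fin n) (Fin n) ℂ) + (a ^ 2) • G⁻¹ := by
    rw [conjTranspose_sub, conjTranspose_smul, conjTranspose_one, hG.1.eq]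
    simp only [star_trivial, sub_mul, mul_sub, smul_mul_assoc, mul_smul_comm, one_mul, mul_one,
      mul_nonsing_inv _ hu, nonsing_inv_mul _ hu]
    module
  rw [h, ← qf_conj, h2, qf_add, qf_sub, qf_smul, qf_smul]

namespace StableFrame

variable {μ : Measure X} {z : X → Fin n → ℂ} (hz : StableFrame μ z)
include hz

/-- The gap in the Cauchy-Schwarz inequality `1 ≤ ⟨G z, z⟩ ⟨G⁻¹ z, z⟩` is quadratic in the distance
of `G` to the scalar matrices. -/
theorem qf_sub_inv_qf_inv_mem {G : Matrix (Fin n) (Fin n) ℂ} (hG : G.PosDef) {l : ℝ} (hl : 0 < l)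
    (h : ∀ v, l * ‖WithLp.toLp 2 v‖ ^ 2 ≤ qf G v) (c : ℝ) (x : X) :
    0 ≤ qf G (z x) - (qf G⁻¹ (z x))⁻¹ ∧
      qf G (z x) - (qf G⁻¹ (z x))⁻¹ ≤ l⁻¹ * ‖G - c • (1 : Matrix (Fin n) (Fin n) ℂ)‖ ^ 2 := by
  set A := G - c • (1 : Matrix (Fin n) (Fin n) ℂ) with hA
  set a := qf G (z x) with ha
  set b := qf G⁻¹ (z x)
  have ha0 : 0 < a := qf_pos hG (hz.ne_zero x)
  have hb0 : 0 < b := qf_pos hG.inv (hz.ne_zero x)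
  have hAH : A.IsHermitian := by
    refine hG.1.sub ?_
    rw [IsHermitian, conjTranspose_smul, conjTranspose_one, star_trivial]
  set u := G *ᵥ z x - a • z x with hu
  have h1 : qf G⁻¹ u = a * (a * b - 1) := by
    rw [hu, qf_inv_mulVec_sub hG, hz.qf_one]; ring
  have huA : u = A *ᵥ z x - qf A (z x) • z x := by
    rw [hu, hA, sub_mulVec, smul_mulVec, one_mulVec, qf_sub, qf_smul, hz.qf_one, ← ha]
    module
  have h2 : ‖WithLp.toLp 2 u‖ ^ 2 ≤ ‖A‖ ^ 2 := by
    have h3 : qf (Aᴴ * A) (z x) ≤ ‖A‖ ^ 2 := by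
      rw [qf_conjTranspose_mul_self]
      gcongr
      simpa [hz.unit] using norm_toLp_mulVec_le A (z x)
    rw [huA, norm_sq_mulVec_sub hAH, hz.qf_one]
    nlinarith [sq_nonneg (qf A (z x))]
  have h3 := mul_qf_inv_le hG hl.le h u
  have h4 : 0 ≤ qf G⁻¹ u := by
    by_cases h0 : u = 0
    · simp [h0, qf]
    · exact (qf_pos hG.inv h0).le
  have hab : 1 ≤ a * b := by
    rw [h1] at h4
    linarith [nonneg_of_mul_nonneg_right h4 ha0]
  have h5 : a - b⁻¹ = qf G⁻¹ u / (a * b) := by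
    rw [h1]; field_simp
  rw [h5]
  refine ⟨by positivity, (div_le_self h4 hab).trans ?_⟩
  rw [inv_mul_eq_div, le_div_iff₀ hl]
  linarith

theorem integrable_qf_sub_inv_qf_inv {G : Matrix (Fin n) (Fin n) ℂ} (hG : G.PosDef) :
    Integrable (fun x => qf G (z x) - (qf G⁻¹ (z x))⁻¹) μ :=
  (hz.integrable_qf G).sub (hz.integrable_inv_qf hG.inv)

theorem trace_sub_trace_frameMap (hb : frameMap μ z 1 = 1) {G : Matrix (Fin n) (Fin n) ℂ}
    (hG : G.PosDef) : G.trace.re - (frameMap μ z G).trace.re =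
      n * ∫ x, (qf G (z x) - (qf G⁻¹ (z x))⁻¹) ∂μ := by
  have h := hz.trace_mul_frameMap hG 1
  simp only [one_mul, hz.qf_one, mul_one] at h
  rw [h, integral_sub (hz.integrable_qf G) (hz.integrable_inv_qf hG.inv), mul_sub,
    hz.integral_qf_of_balanced hb]

theorem le_qf_frameMap (hb : frameMap μ z 1 = 1) {G : Matrix (Fin n) (Fin n) ℂ} (hG : G.PosDef)
    {l : ℝ} (hl : 0 < l) (h : ∀ v, l * ‖WithLp.toLp 2 v‖ ^ 2 ≤ qf G v) (v : Fin n → ℂ) :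
    l * ‖WithLp.toLp 2 v‖ ^ 2 ≤ qf (frameMap μ z G) v := by
  have h1 : ‖WithLp.toLp 2 v‖ ^ 2 = n * ∫ x, qf (outer v) (z x) ∂μ := by
    rw [hz.integral_qf_of_balanced hb, ← Donaldson.qf_one, qf_eq_trace, one_mul]
  rw [hz.qf_frameMap hG, h1, mul_left_comm, ← integral_const_mul]
  gcongr ?_ * ?_
  refine integral_mono ((hz.integrable_qf _).const_mul l)
    (hz.integrable_mul_qf (hz.integrable_inv_qf hG.inv) _) fun x => ?_
  dsimp only
  gcongr
  · rw [qf_outer]; positivity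
  · have h2 := mul_qf_inv_le hG hl.le h (z x)
    rw [hz.unit, one_pow] at h2
    rw [le_inv_comm₀ hl (qf_pos hG.inv (hz.ne_zero x)), inv_eq_one_div l, le_div_iff₀ hl]
    linarith

theorem norm_frameMap_sub_le (hb : frameMap μ z 1 = 1) {β : ℝ}
    (hβ : ∀ A : Matrix (Fin n) (Fin n) ℂ, A.IsHermitian → A.trace.re = 0 →
      ‖(n : ℝ) • ∫ x, qf A (z x) • outer (z x) ∂μ‖ ≤ β * ‖A‖)
    {G : Matrix (Fin n) (Fin n) ℂ} (hG : G.PosDef) :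
    ‖frameMap μ z G - ((frameMap μ z G).trace.re / n) • (1 : Matrix (Fin n) (Fin n) ℂ)‖ ≤
      β * ‖G - (G.trace.re / n) • (1 : Matrix (Fin n) (Fin n) ℂ)‖ +
        2 * (G.trace.re - (frameMap μ z G).trace.re) := by
  have hn : (0 : ℝ) < n := by exact_mod_cast hz.pos
  set c := G.trace.re / n with hc
  set c' := (frameMap μ z G).trace.re / n with hc'
  set A := G - c • (1 : Matrix (Fin n) (Fin n) ℂ) with hA
  set w : X → ℝ := fun x => qf G (z x) - (qf G⁻¹ (z x))⁻¹ with hw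
  have hwi : Integrable w μ := hz.integrable_qf_sub_inv_qf_inv hG
  obtain ⟨l, hl, hlG⟩ := exists_mul_norm_sq_le_qf hG
  have hw0 : ∀ x, 0 ≤ w x := fun x => (hz.qf_sub_inv_qf_inv_mem hG hl hlG c x).1
  have htr : G.trace.re - (frameMap μ z G).trace.re = n * ∫ x, w x ∂μ :=
    hz.trace_sub_trace_frameMap hb hG
  have hone : (n : ℝ) • ∫ x, outer (z x) ∂μ = 1 := by
    have h := hb
    simp only [frameMap, inv_one, hz.qf_one, one_smul] at h
    exact h
  have hAH : A.IsHermitian := by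
    refine hG.1.sub ?_
    rw [IsHermitian, conjTranspose_smul, conjTranspose_one, star_trivial]
  have hA0 : A.trace.re = 0 := by
    simp [hA, hc, hn.ne']
  have hio : Integrable (fun x => outer (z x)) μ := by
    have := hz.prob
    simpa using hz.integrable_smul_outer (integrable_const (1 : ℝ))
  have hsplit : frameMap μ z G - c' • (1 : Matrix (Fin n) (Fin n) ℂ) =
      ((n : ℝ) • ∫ x, qf A (z x) • outer (z x) ∂μ) + (c - c') • (1 : Matrix (Fin n) (Fin n) ℂ)
        - (n : ℝ) • ∫ x, w x • outer (z x) ∂μ := by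
    have h1 : ∀ x, (qf G⁻¹ (z x))⁻¹ • outer (z x) =
        qf A (z x) • outer (z x) + c • outer (z x) - w x • outer (z x) := fun x => by
      rw [hA, qf_sub, qf_smul, hz.qf_one, hw]
      module
    have hi1 := hz.integrable_smul_outer (hz.integrable_qf A)
    have hi2 := hz.integrable_smul_outer hwi
    have hi3 : Integrable (fun x => c • outer (z x)) μ := hio.smul c
    have hi4 : Integrable (fun x => qf A (z x) • outer (z x) + c • outer (z x)) μ := hi1.add hi3
    have h2 : ∫ x, (qf G⁻¹ (z x))⁻¹ • outer (z x) ∂μ = ∫ x, qf A (z x) • outer (z x) ∂μ +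
        c • ∫ x, outer (z x) ∂μ - ∫ x, w x • outer (z x) ∂μ := by
      simp only [h1]
      rw [integral_sub hi4 hi2, integral_add hi1 hi3, integral_smul]
    rw [frameMap, h2, smul_sub, smul_add, smul_comm (n : ℝ) c, hone]
    module
  have hcc : c - c' = ∫ x, w x ∂μ := by
    rw [hc, hc', ← sub_div, htr]; field_simp
  have hi0 : 0 ≤ ∫ x, w x ∂μ := integral_nonneg hw0
  have hnone : ‖(1 : Matrix (Fin n) (Fin n) ℂ)‖ ≤ n := by
    refine (sq_le_sq₀ (norm_nonneg _) hn.le).1 ?_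
    rw [frobenius_norm_sq]
    simp only [conjTranspose_one, mul_one, trace_one, Fintype.card_fin, Complex.natCast_re]
    exact_mod_cast Nat.le_self_pow two_ne_zero n
  have hb1 : ‖(c - c') • (1 : Matrix (Fin n) (Fin n) ℂ)‖ ≤
      G.trace.re - (frameMap μ z G).trace.re := by
    rw [norm_smul, hcc, htr, Real.norm_eq_abs, abs_of_nonneg hi0, mul_comm]
    gcongr
  have hb2 : ‖(n : ℝ) • ∫ x, w x • outer (z x) ∂μ‖ ≤
      G.trace.re - (frameMap μ z G).trace.re := by
    rw [norm_smul, htr, Real.norm_natCast]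
    gcongr
    refine (hz.norm_integral_le w).trans (le_of_eq ?_)
    simp only [abs_of_nonneg (hw0 _)]
  rw [hsplit]
  refine (norm_sub_le _ _).trans ?_
  have h3 := norm_add_le ((n : ℝ) • ∫ x, qf A (z x) • outer (z x) ∂μ)
    ((c - c') • (1 : Matrix (Fin n) (Fin n) ℂ))
  linarith [hβ A hAH hA0]

theorem posDef_iterate {G : Matrix (Fin n) (Fin n) ℂ} (hG : G.PosDef) (r : ℕ) :
    ((frameMap μ z)^[r] G).PosDef := by
  induction r with
  | zero => exact hG
  | succ r ih => rw [Function.iterate_succ_apply']; exact hz.posDef_frameMap ih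

theorem exists_dist_iterate_le_of_balanced (hb : frameMap μ z 1 = 1)
    {G : Matrix (Fin n) (Fin n) ℂ} (hG : G.PosDef) :
    ∃ c C γ : ℝ, 0 < c ∧ 0 < C ∧ 0 < γ ∧ γ < 1 ∧
      ∀ r : ℕ, ‖(frameMap μ z)^[r] G - c • (1 : Matrix (Fin n) (Fin n) ℂ)‖ ≤ C * γ ^ r := by
  have hn : (0 : ℝ) < n := by exact_mod_cast hz.pos
  obtain ⟨β, hβ0, hβ1, hβ⟩ := hz.exists_spectral_gap hb
  obtain ⟨l, hl, hlG⟩ := exists_mul_norm_sq_le_qf hG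
  set g : ℕ → Matrix (Fin n) (Fin n) ℂ := fun r => (frameMap μ z)^[r] G with hg
  have hg1 : ∀ r, g (r + 1) = frameMap μ z (g r) := fun r => Function.iterate_succ_apply' _ _ _
  have hgp : ∀ r, (g r).PosDef := fun r => hz.posDef_iterate hG r
  have hgl : ∀ r v, l * ‖WithLp.toLp 2 v‖ ^ 2 ≤ qf (g r) v := by
    intro r
    induction r with
    | zero => exact hlG
    | succ r ih => rw [hg1]; exact hz.le_qf_frameMap hb (hgp r) hl ih
  have hmem := fun r x => hz.qf_sub_inv_qf_inv_mem (hgp r) hl (hgl r) ((g r).trace.re / n) x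
  have hdiff : ∀ r, (g r).trace.re - (g (r + 1)).trace.re =
      n * ∫ x, (qf (g r) (z x) - (qf (g r)⁻¹ (z x))⁻¹) ∂μ := fun r => by
    rw [hg1]; exact hz.trace_sub_trace_frameMap hb (hgp r)
  have htrl : ∀ r, n * l ≤ (g r).trace.re := fun r => by
    rw [← hz.integral_qf_of_balanced hb]
    gcongr
    have := hz.prob
    have h := integral_mono (integrable_const l) (hz.integrable_qf (g r)) (fun x => by
      simpa [hz.unit] using hgl r (z x))
    simpa using h
  obtain ⟨τ', C, γ, hC, hγ0, hγ1, hlim, hbound⟩ := exists_geometric_bound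
    (e := fun r => ‖g r - ((g r).trace.re / n) • (1 : Matrix (Fin n) (Fin n) ℂ)‖)
    (τ := fun r => (g r).trace.re) (K := n * l⁻¹) hβ0 hβ1 (fun r => norm_nonneg _)
    (fun r => (by positivity : 0 ≤ n * l).trans (htrl r))
    (fun r => by
      rw [← sub_nonneg, hdiff]
      exact mul_nonneg hn.le (integral_nonneg fun x => (hmem r x).1))
    (fun r => by
      rw [hg1]
      exact hz.norm_frameMap_sub_le hb hβ (hgp r))
    (fun r => by
      rw [hdiff, mul_assoc]
      gcongr
      have := hz.prob
      have h := integral_mono (hz.integrable_qf_sub_inv_qf_inv (hgp r)) (integrable_const _)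
        (fun x => (hmem r x).2)
      simpa using h)
  have hτ' : n * l ≤ τ' := ge_of_tendsto' hlim htrl
  have hτ'0 : 0 < τ' := (by positivity : 0 < n * l).trans_le hτ'
  refine ⟨τ' / n, C + C / n * ‖(1 : Matrix (Fin n) (Fin n) ℂ)‖, γ, by positivity, by positivity,
    hγ0, hγ1, fun r => ?_⟩
  have h1 : g r - (τ' / n) • (1 : Matrix (Fin n) (Fin n) ℂ) =
      (g r - ((g r).trace.re / n) • (1 : Matrix (Fin n) (Fin n) ℂ)) +
        (((g r).trace.re - τ') / n) • (1 : Matrix (Fin n) (Fin n) ℂ) := by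
    rw [sub_div]; module
  change ‖g r - _‖ ≤ _
  rw [h1]
  refine (norm_add_le _ _).trans ?_
  rw [norm_smul, norm_div, Real.norm_natCast, Real.norm_eq_abs, add_mul]
  have h2 : |(g r).trace.re - τ'| / n * ‖(1 : Matrix (Fin n) (Fin n) ℂ)‖ ≤
      C * γ ^ r / n * ‖(1 : Matrix (Fin n) (Fin n) ℂ)‖ := by
    gcongr
    exact (hbound r).2
  calc _ ≤ C * γ ^ r + C * γ ^ r / n * ‖(1 : Matrix (Fin n) (Fin n) ℂ)‖ :=
        add_le_add (hbound r).1 h2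
    _ = _ := by ring

end StableFrame

/-! ### Existence of a fixed point -/

theorem continuous_conjDiag :
    Continuous fun p : Matrix (Fin n) (Fin n) ℂ × (Fin n → ℝ) => conjDiag p.1 p.2 := by
  have h : Continuous fun d : Fin n → ℝ => diagonal fun i => (d i : ℂ) := by
    refine Continuous.matrix_diagonal ?_
    fun_prop
  exact (continuous_fst.mul (h.comp continuous_snd)).mul (continuous_star.comp continuous_fst)

theorem continuous_conjDiag_left (d : Fin n → ℝ) :
    Continuous fun U : Matrix (Fin n) (Fin n) ℂ => conjDiag U d :=
  (continuous_id.mul continuous_const).mul continuous_star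

theorem isCompact_unitaryGroup :
    IsCompact (unitaryGroup (Fin n) ℂ : Set (Matrix (Fin n) (Fin n) ℂ)) := by
  refine Metric.isCompact_of_isClosed_isBounded ?_ ?_
  · have : (unitaryGroup (Fin n) ℂ : Set (Matrix (Fin n) (Fin n) ℂ)) = {U | U * star U = 1} := by
      ext U
      exact mem_unitaryGroup_iff
    rw [this]
    exact isClosed_eq (continuous_id.mul continuous_star) continuous_const
  · refine isBounded_iff_forall_norm_le.2 ⟨n, fun U hU => ?_⟩
    refine (sq_le_sq₀ (norm_nonneg _) (Nat.cast_nonneg n)).1 ?_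
    have h := mem_unitaryGroup_iff'.1 hU
    rw [star_eq_conjTranspose] at h
    rw [frobenius_norm_sq, h]
    simp only [trace_one, Fintype.card_fin, Complex.natCast_re]
    exact_mod_cast Nat.le_self_pow two_ne_zero n

theorem qf_conjDiag_indicator (U : Matrix (Fin n) (Fin n) ℂ) (s : Finset (Fin n))
    (v : Fin n → ℂ) :
    qf (conjDiag U fun i => if i ∈ s then 1 else 0) v = ∑ i ∈ s, ‖(Uᴴ *ᵥ v) i‖ ^ 2 := by
  simp [qf_conjDiag]

/-- The vectors orthogonal to the columns of `U` with index in `s`. -/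
def orthCols (U : Matrix (Fin n) (Fin n) ℂ) (s : Finset (Fin n)) : Submodule ℂ (Fin n → ℂ) :=
  LinearMap.ker (LinearMap.funLeft ℂ ℂ (Subtype.val : s → Fin n) ∘ₗ mulVecLin Uᴴ)

theorem mem_orthCols {U : Matrix (Fin n) (Fin n) ℂ} {s : Finset (Fin n)} {v : Fin n → ℂ} :
    v ∈ orthCols U s ↔ ∑ i ∈ s, ‖(Uᴴ *ᵥ v) i‖ ^ 2 = 0 := by
  rw [Finset.sum_eq_zero_iff_of_nonneg fun i _ => sq_nonneg _, orthCols, LinearMap.mem_ker,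
    funext_iff]
  simp [LinearMap.funLeft_apply]

theorem finrank_orthCols {U : Matrix (Fin n) (Fin n) ℂ} (hU : U ∈ unitaryGroup (Fin n) ℂ)
    (s : Finset (Fin n)) : Module.finrank ℂ (orthCols U s) + s.card = n := by
  have h := mem_unitaryGroup_iff'.1 hU
  rw [star_eq_conjTranspose] at h
  have hsurj : Function.Surjective
      (LinearMap.funLeft ℂ ℂ (Subtype.val : s → Fin n) ∘ₗ mulVecLin Uᴴ) := by
    rw [LinearMap.coe_comp]
    refine (LinearMap.funLeft_surjective_of_injective ℂ ℂ _ Subtype.val_injective).comp ?_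
    intro v
    exact ⟨U *ᵥ v, by simp [h]⟩
  have h1 := LinearMap.finrank_range_add_finrank_ker
    (LinearMap.funLeft ℂ ℂ (Subtype.val : s → Fin n) ∘ₗ mulVecLin Uᴴ)
  rw [LinearMap.range_eq_top.2 hsurj, finrank_top, Module.finrank_fin_fun,
    Module.finrank_fintype_fun_eq_card, Fintype.card_coe] at h1
  rw [orthCols]
  omega

theorem exists_partial_sum_ge {m : ℕ} {b S : ℕ → ℝ} {ε : ℝ} (hb : ∀ j < m, b (j + 1) ≤ b j)
    (hS : ε ≤ S m) : ∃ j ≤ m, ε ≤ S j ∧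
      b 0 + ∑ j ∈ Finset.range m, (if S j < ε then b (j + 1) - b j else 0) ≤ b j := by
  have key : ∀ k ≤ m, (b 0 + ∑ j ∈ Finset.range k, (if S j < ε then b (j + 1) - b j else 0) ≤ b k) ∨
      ∃ j ≤ m, ε ≤ S j ∧
        b 0 + ∑ j ∈ Finset.range k, (if S j < ε then b (j + 1) - b j else 0) ≤ b j := by
    intro k
    induction k with
    | zero => intro _; left; simp
    | succ k ih =>
      intro hk
      rw [Finset.sum_range_succ]
      have hbk := hb k hk
      by_cases hSk : S k < ε
      · rw [if_pos hSk]
        rcases ih (by omega) with h | ⟨j, hj, hj1, hj2⟩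
        · left; linarith
        · right; exact ⟨j, hj, hj1, by linarith⟩
      · rw [if_neg hSk]
        right
        rcases ih (by omega) with h | ⟨j, hj, hj1, hj2⟩
        · exact ⟨k, by omega, not_lt.1 hSk, by linarith⟩
        · exact ⟨j, hj, hj1, by linarith⟩
  rcases key m le_rfl with h | h
  · exact ⟨m, le_rfl, hS, h⟩
  · exact h

theorem sum_range_abel (b : ℕ → ℝ) (N δ : ℝ) (hN : N ≠ 0) (k : ℕ) :
    b 0 + ∑ j ∈ Finset.range k, (1 - (j + 1 : ℕ) / N - δ) * (b (j + 1) - b j) =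
      (∑ j ∈ Finset.range k, b j) / N + (1 - k / N) * b k + δ * (b 0 - b k) := by
  induction k with
  | zero => simp
  | succ k ih =>
    rw [Finset.sum_range_succ, Finset.sum_range_succ, ← add_assoc, ih]
    push_cast
    field_simp
    ring

namespace StableFrame

variable {μ : Measure X} {z : X → Fin n → ℂ} (hz : StableFrame μ z)
include hz

theorem exists_measure_lt {U : Matrix (Fin n) (Fin n) ℂ} (hU : U ∈ unitaryGroup (Fin n) ℂ)
    {s : Finset (Fin n)} (hs : s.Nonempty) (hs' : s ≠ Finset.univ) :
    ∃ ε > 0, μ.real {x | ∑ i ∈ s, ‖(Uᴴ *ᵥ z x) i‖ ^ 2 < ε} < 1 - s.card / n := by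
  have := hz.prob
  have hn : (0 : ℝ) < n := by exact_mod_cast hz.pos
  have hr := finrank_orthCols hU s
  have hcard : s.card < n := by
    have := Finset.card_lt_univ_of_notMem (s := s) (x := (not_forall.1 fun h =>
      hs' (Finset.eq_univ_iff_forall.2 h)).choose) (not_forall.1 fun h =>
      hs' (Finset.eq_univ_iff_forall.2 h)).choose_spec
    simpa using this
  have hb : orthCols U s ≠ ⊥ := fun h => by
    rw [h, finrank_bot] at hr
    omega
  have ht : orthCols U s ≠ ⊤ := fun h => by
    rw [h, finrank_top, Module.finrank_fin_fun] at hr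
    have := hs.card_pos
    omega
  have h1 := hz.stable _ hb ht
  have h2 : (Module.finrank ℂ (orthCols U s) : ℝ) / n = 1 - s.card / n := by
    rw [eq_sub_iff_add_eq, ← add_div, div_eq_one_iff_eq hn.ne']
    exact_mod_cast hr
  rw [h2] at h1
  have hmeas : Measurable fun x => ∑ i ∈ s, ‖(Uᴴ *ᵥ z x) i‖ ^ 2 := by
    simpa only [qf_conjDiag_indicator] using
      hz.measurable_qf (conjDiag U fun i => if i ∈ s then 1 else 0)
  have hlim := tendsto_measure_biInter_gt (μ := μ) (a := (0 : ℝ))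
    (s := fun ε => {x | ∑ i ∈ s, ‖(Uᴴ *ᵥ z x) i‖ ^ 2 < ε})
    (fun ε _ => (measurableSet_lt hmeas measurable_const).nullMeasurableSet)
    (fun i j _ hij x (hx : _ < i) => hx.trans_le hij) ⟨1, one_pos, measure_ne_top _ _⟩
  have hset : (⋂ r > (0 : ℝ), {x | ∑ i ∈ s, ‖(Uᴴ *ᵥ z x) i‖ ^ 2 < r}) =
      {x | z x ∈ orthCols U s} := by
    ext x
    simp only [Set.mem_iInter, Set.mem_ofPred_eq, mem_orthCols]
    constructor
    · intro h
      refine le_antisymm (le_of_forall_gt h) (Finset.sum_nonneg fun i _ => sq_nonneg _)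
    · intro h r hr
      rw [h]
      exact hr
  rw [hset] at hlim
  have hlim2 := (ENNReal.tendsto_toReal (measure_ne_top μ _)).comp hlim
  obtain ⟨ε, h3, h4⟩ := ((hlim2.eventually (gt_mem_nhds h1)).and self_mem_nhdsWithin).exists
  exact ⟨ε, h4, h3⟩

/-- The stability condition, uniformly on small neighbourhoods of proper subspaces. -/
theorem exists_uniform_measure_le : ∃ ε > 0, ε ≤ 1 ∧ ∀ U ∈ unitaryGroup (Fin n) ℂ,
    ∀ s : Finset (Fin n), s.Nonempty → s ≠ Finset.univ →
      μ.real {x | ∑ i ∈ s, ‖(Uᴴ *ᵥ z x) i‖ ^ 2 < ε} ≤ 1 - s.card / n - ε := by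
  have := hz.prob
  have key : ∀ s : Finset (Fin n), s.Nonempty → s ≠ Finset.univ → ∀ᶠ ε : ℝ in 𝓝 0,
      ∀ U ∈ (unitaryGroup (Fin n) ℂ : Set (Matrix (Fin n) (Fin n) ℂ)),
        μ.real {x | ∑ i ∈ s, ‖(Uᴴ *ᵥ z x) i‖ ^ 2 < ε} ≤ 1 - s.card / n - ε := by
    intro s hs hs'
    refine isCompact_unitaryGroup.eventually_forall_of_forall_eventually fun U hU => ?_
    obtain ⟨ε, hε, h⟩ := hz.exists_measure_lt hU hs hs'
    let f : Matrix (Fin n) (Fin n) ℂ → Matrix (Fin n) (Fin n) ℂ :=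
      fun V => conjDiag V fun i => if i ∈ s then 1 else 0
    have hf : Continuous f := continuous_conjDiag_left _
    have hη : 0 < 1 - s.card / n - μ.real {x | ∑ i ∈ s, ‖(Uᴴ *ᵥ z x) i‖ ^ 2 < ε} := by linarith
    have e1 : ∀ᶠ p : ℝ × Matrix (Fin n) (Fin n) ℂ in 𝓝 (0, U), p.1 < ε / 2 :=
      continuous_fst.continuousAt.eventually (gt_mem_nhds (half_pos hε))
    have e2 : ∀ᶠ p : ℝ × Matrix (Fin n) (Fin n) ℂ in 𝓝 (0, U),
        p.1 < 1 - s.card / n - μ.real {x | ∑ i ∈ s, ‖(Uᴴ *ᵥ z x) i‖ ^ 2 < ε} :=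
      continuous_fst.continuousAt.eventually (gt_mem_nhds hη)
    have e3 : ∀ᶠ p : ℝ × Matrix (Fin n) (Fin n) ℂ in 𝓝 (0, U), ‖f U - f p.2‖ < ε / 2 := by
      have hc : Continuous fun p : ℝ × Matrix (Fin n) (Fin n) ℂ => ‖f U - f p.2‖ :=
        (continuous_const.sub (hf.comp continuous_snd)).norm
      exact hc.continuousAt.eventually (gt_mem_nhds (by simpa using half_pos hε))
    filter_upwards [e1, e2, e3] with p h1 h2 h3
    have hsub : {x | ∑ i ∈ s, ‖(p.2ᴴ *ᵥ z x) i‖ ^ 2 < p.1} ⊆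
        {x | ∑ i ∈ s, ‖(Uᴴ *ᵥ z x) i‖ ^ 2 < ε} := by
      intro x hx
      have h4 := (le_abs_self _).trans (hz.abs_qf_le (f U - f p.2) x)
      rw [qf_sub, qf_conjDiag_indicator, qf_conjDiag_indicator] at h4
      simp only [Set.mem_ofPred_eq] at hx ⊢
      linarith
    have h5 := measureReal_mono hsub (measure_ne_top μ _)
    linarith
  have hall : ∀ᶠ ε : ℝ in 𝓝 0, ∀ s : Finset (Fin n), s.Nonempty → s ≠ Finset.univ →
      ∀ U ∈ (unitaryGroup (Fin n) ℂ : Set (Matrix (Fin n) (Fin n) ℂ)),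
        μ.real {x | ∑ i ∈ s, ‖(Uᴴ *ᵥ z x) i‖ ^ 2 < ε} ≤ 1 - s.card / n - ε := by
    refine eventually_all.2 fun s => ?_
    by_cases h : s.Nonempty ∧ s ≠ Finset.univ
    · filter_upwards [key s h.1 h.2] with ε hε _ _ using hε
    · exact .of_forall fun ε h1 h2 => absurd ⟨h1, h2⟩ h
  obtain ⟨ε, ⟨h1, h2⟩, h3⟩ := (((hall.and (gt_mem_nhds one_pos)).filter_mono
    nhdsWithin_le_nhds).and (self_mem_nhdsWithin (s := Set.Ioi (0 : ℝ)))).exists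
  exact ⟨ε, h3, h2.le, fun U hU s hs hs' => h1 s hs hs' U hU⟩

omit [MeasurableSpace X] hz in
theorem abs_log_qf_le {H : Matrix (Fin n) (Fin n) ℂ} {a b : ℝ} (ha : 0 < a) {x : X}
    (h1 : a ≤ qf H (z x)) (h2 : qf H (z x) ≤ b) :
    |Real.log (qf H (z x))| ≤ |Real.log a| + |Real.log b| := by
  have h3 := Real.log_le_log ha h1
  have h4 := Real.log_le_log (ha.trans_le h1) h2
  rw [abs_le]
  constructor
  · linarith [neg_abs_le (Real.log a), abs_nonneg (Real.log b)]
  · linarith [le_abs_self (Real.log b), abs_nonneg (Real.log a)]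

theorem integrable_log_qf {H : Matrix (Fin n) (Fin n) ℂ} (hH : H.PosDef) :
    Integrable (fun x => Real.log (qf H (z x))) μ := by
  have := hz.prob
  obtain ⟨c, hc, h⟩ := exists_mul_norm_sq_le_qf hH
  refine Integrable.of_bound (Real.measurable_log.comp (hz.measurable_qf H)).aestronglyMeasurable
    (|Real.log c| + |Real.log ‖H‖|) (.of_forall fun x => ?_)
  have hx := h (z x)
  rw [hz.unit, one_pow, mul_one] at hx
  exact abs_log_qf_le hc hx ((le_abs_self _).trans (hz.abs_qf_le H x))

/-- The functional whose minima are the fixed points of `frameMap` is coercive modulo scaling. -/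
theorem le_integral_log_qf {ε : ℝ} (hε : 0 < ε) (hε1 : ε ≤ 1)
    (h : ∀ U ∈ unitaryGroup (Fin n) ℂ, ∀ s : Finset (Fin n), s.Nonempty → s ≠ Finset.univ →
      μ.real {x | ∑ i ∈ s, ‖(Uᴴ *ᵥ z x) i‖ ^ 2 < ε} ≤ 1 - s.card / n - ε)
    {U : Matrix (Fin n) (Fin n) ℂ} (hU : U ∈ unitaryGroup (Fin n) ℂ) {d : Fin n → ℝ}
    (hd : ∀ i, 0 < d i) (p q : Fin n) :
    Real.log ε + (∑ i, Real.log (d i)) / n + ε * (Real.log (d p) - Real.log (d q)) ≤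
      ∫ x, Real.log (qf (conjDiag U d) (z x)) ∂μ := by
  have := hz.prob
  obtain ⟨m, rfl⟩ := Nat.exists_eq_succ_of_ne_zero hz.pos.ne'
  let σ : Equiv.Perm (Fin (m + 1)) := Tuple.sort fun i => -Real.log (d i)
  have hσ : ∀ i j, i ≤ j → Real.log (d (σ j)) ≤ Real.log (d (σ i)) := fun i j hij =>
    neg_le_neg_iff.1 (Tuple.monotone_sort (fun i => -Real.log (d i)) hij)
  let cl : ℕ → Fin (m + 1) := fun j => ⟨min j m, by omega⟩
  have hcl : ∀ {i j}, i ≤ j → cl i ≤ cl j := fun {i j} hij => by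
    simp only [cl, Fin.mk_le_mk]; omega
  let b : ℕ → ℝ := fun j => Real.log (d (σ (cl j)))
  have hb : ∀ j < m, b (j + 1) ≤ b j := fun j _ => hσ _ _ (hcl (Nat.le_succ j))
  let s : ℕ → Finset (Fin (m + 1)) := fun j => (Finset.Iic (cl j)).map σ.toEmbedding
  have hscard : ∀ j ≤ m, (s j).card = j + 1 := fun j hj => by
    simp [s, cl, hj]
  let S : ℕ → X → ℝ := fun j x => ∑ i ∈ s j, ‖(Uᴴ *ᵥ z x) i‖ ^ 2
  have hSmeas : ∀ j, Measurable (S j) := fun j => by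
    simpa only [qf_conjDiag_indicator] using
      hz.measurable_qf (conjDiag U fun i => if i ∈ s j then 1 else 0)
  have hSm : ∀ x, S m x = 1 := fun x => by
    have : s m = Finset.univ := Finset.eq_univ_of_card _ (by rw [hscard m le_rfl]; simp)
    simp only [S, this]
    rw [sum_norm_sq_conjTranspose_mulVec hU, hz.unit, one_pow]
  have hpt : ∀ x, Real.log ε + (b 0 + ∑ j ∈ Finset.range m,
      {x | S j x < ε}.indicator (fun _ => b (j + 1) - b j) x) ≤
        Real.log (qf (conjDiag U d) (z x)) := by
    intro x
    obtain ⟨j, hj, hj1, hj2⟩ := exists_partial_sum_ge (S := fun j => S j x) (ε := ε) hb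
      (by simpa only [hSm] using hε1)
    have hle : d (σ (cl j)) * ε ≤ qf (conjDiag U d) (z x) := by
      rw [qf_conjDiag]
      calc d (σ (cl j)) * ε ≤ d (σ (cl j)) * S j x := by
            have := (hd (σ (cl j))).le
            gcongr
        _ = ∑ i ∈ s j, d (σ (cl j)) * ‖(Uᴴ *ᵥ z x) i‖ ^ 2 := Finset.mul_sum _ _ _
        _ ≤ ∑ i ∈ s j, d i * ‖(Uᴴ *ᵥ z x) i‖ ^ 2 := by
            refine Finset.sum_le_sum fun i hi => ?_
            gcongr
            simp only [s, Finset.mem_map, Finset.mem_Iic] at hi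
            obtain ⟨k, hk, rfl⟩ := hi
            exact (Real.log_le_log_iff (hd _) (hd _)).1 (hσ _ _ hk)
        _ ≤ ∑ i, d i * ‖(Uᴴ *ᵥ z x) i‖ ^ 2 :=
            Finset.sum_le_univ_sum_of_nonneg fun i => mul_nonneg (hd i).le (sq_nonneg _)
    have hlog := Real.log_le_log (mul_pos (hd _) hε) hle
    rw [Real.log_mul (hd _).ne' hε.ne'] at hlog
    have hj3 : b 0 + ∑ j ∈ Finset.range m,
        {x | S j x < ε}.indicator (fun _ => b (j + 1) - b j) x ≤ b j := hj2
    have hbj : b j = Real.log (d (σ (cl j))) := rfl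
    linarith
  have hind : ∀ j ∈ Finset.range m,
      Integrable ({x | S j x < ε}.indicator fun _ => b (j + 1) - b j) μ := fun j _ =>
    (integrable_const _).indicator (measurableSet_lt (hSmeas j) measurable_const)
  have hI1 : Integrable (fun x => ∑ j ∈ Finset.range m,
      {x | S j x < ε}.indicator (fun _ => b (j + 1) - b j) x) μ := integrable_finsetSum _ hind
  have hI2 : Integrable (fun x => b 0 + ∑ j ∈ Finset.range m,
      {x | S j x < ε}.indicator (fun _ => b (j + 1) - b j) x) μ := (integrable_const _).add hI1
  have hI3 : Integrable (fun x => Real.log ε + (b 0 + ∑ j ∈ Finset.range m,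
      {x | S j x < ε}.indicator (fun _ => b (j + 1) - b j) x)) μ := (integrable_const _).add hI2
  have hint : ∫ x, (Real.log ε + (b 0 + ∑ j ∈ Finset.range m,
      {x | S j x < ε}.indicator (fun _ => b (j + 1) - b j) x)) ∂μ =
      Real.log ε + (b 0 + ∑ j ∈ Finset.range m, μ.real {x | S j x < ε} * (b (j + 1) - b j)) := by
    rw [integral_add (integrable_const _) hI2, integral_add (integrable_const _) hI1,
      integral_finsetSum _ hind]
    simp only [integral_const, probReal_univ, one_smul]
    congr 2
    refine Finset.sum_congr rfl fun j _ => ?_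
    rw [integral_indicator_const _ (measurableSet_lt (hSmeas j) measurable_const), smul_eq_mul]
  have hmono := integral_mono hI3 (hz.integrable_log_qf (posDef_conjDiag hU hd)) hpt
  rw [hint] at hmono
  have hsum : ∑ j ∈ Finset.range m, (1 - (j + 1 : ℕ) / ((m + 1 : ℕ) : ℝ) - ε) * (b (j + 1) - b j) ≤
      ∑ j ∈ Finset.range m, μ.real {x | S j x < ε} * (b (j + 1) - b j) := by
    refine Finset.sum_le_sum fun j hj => ?_
    rw [Finset.mem_range] at hj
    refine mul_le_mul_of_nonpos_right ?_ (sub_nonpos.2 (hb j hj))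
    have h1 := h U hU (s j) (Finset.card_pos.1 (by rw [hscard j hj.le]; omega)) (fun hu => by
      have := hscard j hj.le
      rw [hu, Finset.card_univ, Fintype.card_fin] at this
      omega)
    rwa [hscard j hj.le] at h1
  have habel := sum_range_abel b ((m + 1 : ℕ) : ℝ) ε (by positivity) m
  have hbsum : ∑ j ∈ Finset.range (m + 1), b j = ∑ i, Real.log (d i) := by
    rw [Finset.sum_range, ← Equiv.sum_comp σ fun i => Real.log (d i)]
    refine Finset.sum_congr rfl fun i _ => ?_
    have : cl i = i := by
      ext
      simp only [cl]
      omega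
    simp only [b, this]
  rw [Finset.sum_range_succ] at hbsum
  have hlast : (∑ j ∈ Finset.range m, b j) / ((m + 1 : ℕ) : ℝ) + (1 - m / ((m + 1 : ℕ) : ℝ)) * b m =
      (∑ i, Real.log (d i)) / ((m + 1 : ℕ) : ℝ) := by
    rw [← hbsum]
    push_cast
    field_simp
    ring
  have hp : Real.log (d p) ≤ b 0 := by
    have := hσ (cl 0) (σ.symm p) (by simp [cl])
    rwa [Equiv.apply_symm_apply] at this
  have hq : b m ≤ Real.log (d q) := by
    have := hσ (σ.symm q) (cl m) (by simp only [cl, Fin.le_def]; omega)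
    rwa [Equiv.apply_symm_apply] at this
  have hpq : ε * (Real.log (d p) - Real.log (d q)) ≤ ε * (b 0 - b m) := by gcongr
  linarith

end StableFrame

theorem log_det_conjDiag {U : Matrix (Fin n) (Fin n) ℂ} (hU : U ∈ unitaryGroup (Fin n) ℂ)
    {d : Fin n → ℝ} (hd : ∀ i, 0 < d i) :
    Real.log (conjDiag U d).det.re = ∑ i, Real.log (d i) := by
  rw [det_conjDiag hU, Complex.ofReal_re, Real.log_prod fun i _ => (hd i).ne']

theorem log_det_nonpos_of_trace_eq {M : Matrix (Fin n) (Fin n) ℂ} (hM : M.PosDef)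
    (ht : M.trace.re = n) :
    Real.log M.det.re ≤ 0 ∧ (Real.log M.det.re = 0 → M = 1) := by
  obtain ⟨U, hU, d, hd, rfl⟩ := exists_eq_conjDiag hM
  rw [trace_conjDiag hU, Complex.ofReal_re] at ht
  rw [log_det_conjDiag hU hd]
  have hs : ∑ i, (d i - 1) = 0 := by simp [ht]
  have hle : ∀ i ∈ Finset.univ, Real.log (d i) ≤ d i - 1 := fun i _ =>
    Real.log_le_sub_one_of_pos (hd i)
  refine ⟨hs ▸ Finset.sum_le_sum hle, fun h0 => ?_⟩
  have heq := (Finset.sum_eq_sum_iff_of_le hle).1 (h0.trans hs.symm)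
  have hd1 : d = 1 := by
    funext i
    by_contra hne
    exact (Real.log_lt_sub_one_of_pos (hd i) hne).ne (heq i (Finset.mem_univ i))
  rw [hd1, conjDiag_one hU]

theorem conjDiag_smul (U : Matrix (Fin n) (Fin n) ℂ) (c : ℝ) (d : Fin n → ℝ) :
    conjDiag U (c • d) = c • conjDiag U d := by
  have : (diagonal fun i => (((c • d) i : ℝ) : ℂ)) = c • diagonal fun i => (d i : ℂ) := by
    ext i j
    by_cases h : i = j <;> simp [diagonal, h]
  rw [conjDiag, this, mul_smul_comm, smul_mul_assoc, conjDiag]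

namespace StableFrame

variable {μ : Measure X} {z : X → Fin n → ℂ} (hz : StableFrame μ z)
include hz

theorem qf_conjDiag_mem {U : Matrix (Fin n) (Fin n) ℂ} (hU : U ∈ unitaryGroup (Fin n) ℂ)
    {d : Fin n → ℝ} {a b : ℝ} (ha : ∀ i, a ≤ d i) (hb : ∀ i, d i ≤ b) (x : X) :
    a ≤ qf (conjDiag U d) (z x) ∧ qf (conjDiag U d) (z x) ≤ b := by
  have h := sum_norm_sq_conjTranspose_mulVec hU (z x)
  rw [hz.unit, one_pow] at h
  rw [qf_conjDiag]
  constructor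
  · calc a = ∑ i, a * ‖(Uᴴ *ᵥ z x) i‖ ^ 2 := by rw [← Finset.mul_sum, h, mul_one]
      _ ≤ _ := by gcongr; exact ha _
  · calc _ ≤ ∑ i, b * ‖(Uᴴ *ᵥ z x) i‖ ^ 2 := by gcongr; exact hb _
      _ = b := by rw [← Finset.mul_sum, h, mul_one]

theorem continuousOn_integral_log_qf (M : ℝ) :
    ContinuousOn (fun p : Matrix (Fin n) (Fin n) ℂ × (Fin n → ℝ) =>
      ∫ x, Real.log (qf (conjDiag p.1 p.2) (z x)) ∂μ - (∑ i, Real.log (p.2 i)) / n)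
      ((unitaryGroup (Fin n) ℂ : Set (Matrix (Fin n) (Fin n) ℂ)) ×ˢ
        Set.Icc (fun _ => 1) (fun _ => M)) := by
  have := hz.prob
  refine ContinuousOn.sub (continuousOn_of_dominated
    (bound := fun _ => |Real.log 1| + |Real.log M|) ?_ ?_ (integrable_const _) ?_) ?_
  · exact fun p _ => (Real.measurable_log.comp (hz.measurable_qf _)).aestronglyMeasurable
  · rintro p ⟨hp1, hp2⟩
    refine .of_forall fun x => ?_
    have h := hz.qf_conjDiag_mem hp1 hp2.1 hp2.2 x
    exact abs_log_qf_le one_pos h.1 h.2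
  · refine .of_forall fun x => ContinuousOn.log ?_ ?_
    · exact ((continuous_qf (z x)).comp continuous_conjDiag).continuousOn
    · rintro p ⟨hp1, hp2⟩
      exact (one_pos.trans_le (hz.qf_conjDiag_mem hp1 hp2.1 hp2.2 x).1).ne'
  · refine ContinuousOn.div_const (continuousOn_finsetSum _ fun i _ => ContinuousOn.log ?_ ?_) _
    · exact ((continuous_apply i).comp continuous_snd).continuousOn
    · rintro p ⟨hp1, hp2⟩
      exact (one_pos.trans_le (hp2.1 i)).ne'

/-- The functional `H ↦ ∫ log ⟨H z, z⟩ - log det H / n` attains its minimum. -/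
theorem exists_minimizer : ∃ H : Matrix (Fin n) (Fin n) ℂ, H.PosDef ∧
    ∀ H' : Matrix (Fin n) (Fin n) ℂ, H'.PosDef →
      ∫ x, Real.log (qf H (z x)) ∂μ - Real.log H.det.re / n ≤
        ∫ x, Real.log (qf H' (z x)) ∂μ - Real.log H'.det.re / n := by
  have := hz.prob
  have hn : (0 : ℝ) < n := by exact_mod_cast hz.pos
  have : Nonempty (Fin n) := ⟨⟨0, hz.pos⟩⟩
  obtain ⟨ε, hε, hε1, hu⟩ := hz.exists_uniform_measure_le
  set M := Real.exp (-Real.log ε / ε) with hM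
  have hM1 : 1 ≤ M := Real.one_le_exp
    (div_nonneg (neg_nonneg.2 (Real.log_nonpos hε.le hε1)) hε.le)
  let Φ : Matrix (Fin n) (Fin n) ℂ × (Fin n → ℝ) → ℝ := fun p =>
    ∫ x, Real.log (qf (conjDiag p.1 p.2) (z x)) ∂μ - (∑ i, Real.log (p.2 i)) / n
  have h1mem : ((1 : Matrix (Fin n) (Fin n) ℂ), (1 : Fin n → ℝ)) ∈
      (unitaryGroup (Fin n) ℂ : Set (Matrix (Fin n) (Fin n) ℂ)) ×ˢ
        Set.Icc (fun _ : Fin n => (1 : ℝ)) (fun _ => M) :=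
    ⟨one_mem _, le_rfl, fun _ => hM1⟩
  obtain ⟨⟨U, d⟩, ⟨hU, hd⟩, hmin⟩ := (isCompact_unitaryGroup.prod
    (isCompact_Icc (a := fun _ : Fin n => (1 : ℝ)) (b := fun _ => M))).exists_isMinOn ⟨_, h1mem⟩
    (hz.continuousOn_integral_log_qf M)
  have hd0 : ∀ i, 0 < d i := fun i => one_pos.trans_le (hd.1 i)
  have hmin0 : Φ (U, d) ≤ 0 := by
    refine (hmin h1mem).trans (le_of_eq ?_)
    simp [conjDiag_one (one_mem _), hz.qf_one]
  refine ⟨conjDiag U d, posDef_conjDiag hU hd0, fun H' hH' => ?_⟩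
  obtain ⟨V, hV, d', hd', rfl⟩ := exists_eq_conjDiag hH'
  rw [log_det_conjDiag hU hd0, log_det_conjDiag hV hd']
  change Φ (U, d) ≤ Φ (V, d')
  obtain ⟨k, hk⟩ := Finite.exists_min d'
  by_cases hbig : ∃ i, M < (d' k)⁻¹ * d' i
  · obtain ⟨i, hi⟩ := hbig
    refine hmin0.trans ?_
    have h1 := hz.le_integral_log_qf hε hε1 hu hV hd' i k
    have h2 : -Real.log ε / ε ≤ Real.log (d' i) - Real.log (d' k) := by
      rw [← Real.log_div (hd' i).ne' (hd' k).ne', ← Real.log_exp (-Real.log ε / ε), ← hM]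
      refine Real.log_le_log (by positivity) ?_
      rw [div_eq_inv_mul]
      exact hi.le
    rw [div_le_iff₀ hε] at h2
    simp only [Φ]
    linarith
  · push Not at hbig
    have hc : 0 < (d' k)⁻¹ := inv_pos.2 (hd' k)
    have hmem : (V, (d' k)⁻¹ • d') ∈
        (unitaryGroup (Fin n) ℂ : Set (Matrix (Fin n) (Fin n) ℂ)) ×ˢ
          Set.Icc (fun _ : Fin n => (1 : ℝ)) (fun _ => M) := by
      refine ⟨hV, fun i => ?_, fun i => hbig i⟩
      change 1 ≤ (d' k)⁻¹ * d' i
      rw [inv_mul_eq_div, one_le_div (hd' k)]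
      exact hk i
    refine (hmin hmem).trans (le_of_eq ?_)
    have hlog : ∀ x, Real.log (qf (conjDiag V ((d' k)⁻¹ • d')) (z x)) =
        Real.log (d' k)⁻¹ + Real.log (qf (conjDiag V d') (z x)) := fun x => by
      rw [conjDiag_smul, qf_smul,
        Real.log_mul hc.ne' (qf_pos (posDef_conjDiag hV hd') (hz.ne_zero x)).ne']
    have hlog2 : ∀ i, Real.log (((d' k)⁻¹ • d') i) = Real.log (d' k)⁻¹ + Real.log (d' i) :=
      fun i => Real.log_mul hc.ne' (hd' i).ne'
    simp only [Φ, hlog, hlog2]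
    rw [integral_add (integrable_const _) (hz.integrable_log_qf (posDef_conjDiag hV hd'))]
    simp only [integral_const, probReal_univ, one_smul, Finset.sum_add_distrib, Finset.sum_const,
      Finset.card_univ, Fintype.card_fin, nsmul_eq_mul]
    field_simp
    ring

theorem exists_fixedPoint : ∃ G : Matrix (Fin n) (Fin n) ℂ, G.PosDef ∧ frameMap μ z G = G := by
  have := hz.prob
  have hn : (0 : ℝ) < n := by exact_mod_cast hz.pos
  obtain ⟨H, hH, hmin⟩ := hz.exists_minimizer
  have hHu : IsUnit H.det := (isUnit_iff_isUnit_det _).1 hH.isUnit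
  refine ⟨H⁻¹, hH.inv, ?_⟩
  set G' := frameMap μ z H⁻¹ with hG'
  have hG'p : G'.PosDef := hz.posDef_frameMap hH.inv
  have hG'u : IsUnit G'.det := (isUnit_iff_isUnit_det _).1 hG'p.isUnit
  have htr : ∀ A, (A * G').trace.re = n * ∫ x, (qf H (z x))⁻¹ * qf A (z x) ∂μ := fun A => by
    rw [hG', hz.trace_mul_frameMap hH.inv, nonsing_inv_nonsing_inv _ hHu]
  have hpos : ∀ {A : Matrix (Fin n) (Fin n) ℂ}, A.PosDef → ∀ x, 0 < qf A (z x) :=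
    fun hA x => qf_pos hA (hz.ne_zero x)
  have hint : ∫ x, (qf H (z x))⁻¹ * qf G'⁻¹ (z x) ∂μ = 1 := by
    have h := htr G'⁻¹
    rw [nonsing_inv_mul _ hG'u] at h
    simp only [trace_one, Fintype.card_fin, Complex.natCast_re] at h
    exact (mul_right_eq_self₀.1 h.symm).resolve_right hn.ne'
  have hlog : ∫ x, Real.log (qf G'⁻¹ (z x)) ∂μ ≤ ∫ x, Real.log (qf H (z x)) ∂μ := by
    have hi := hz.integrable_mul_qf (hz.integrable_inv_qf hH) G'⁻¹
    have h1 := integral_mono ((hz.integrable_log_qf hG'p.inv).sub (hz.integrable_log_qf hH))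
      (hi.sub (integrable_const (1 : ℝ))) (fun x => by
        have h2 := Real.log_le_sub_one_of_pos
          (mul_pos (inv_pos.2 (hpos hH x)) (hpos hG'p.inv x))
        rw [Real.log_mul (inv_pos.2 (hpos hH x)).ne' (hpos hG'p.inv x).ne', Real.log_inv] at h2
        simp only [Pi.sub_apply]
        linarith)
    simp only [Pi.sub_apply] at h1
    rw [integral_sub (hz.integrable_log_qf hG'p.inv) (hz.integrable_log_qf hH),
      integral_sub hi (integrable_const _), hint] at h1
    simp only [integral_const, probReal_univ, one_smul] at h1
    linarith
  obtain ⟨B, hB, hBG⟩ := exists_eq_conjTranspose_mul_self hG'p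
  have hMp : (B * H * Bᴴ).PosDef :=
    hH.mul_mul_conjTranspose_same (vecMul_injective_of_isUnit ((isUnit_iff_isUnit_det _).2 hB))
  have hMt : (B * H * Bᴴ).trace.re = n := by
    rw [mul_assoc, trace_mul_comm, mul_assoc, ← hBG, htr]
    simp [inv_mul_cancel₀ (hpos hH _).ne']
  obtain ⟨hle, heq⟩ := log_det_nonpos_of_trace_eq hMp hMt
  have hdetpos : ∀ {A : Matrix (Fin n) (Fin n) ℂ}, A.PosDef → 0 < A.det.re ∧ A.det.im = 0 :=
    fun hA => by
      have := Complex.pos_iff.1 hA.det_pos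
      exact ⟨this.1, this.2.symm⟩
  have hdet : Real.log (B * H * Bᴴ).det.re = Real.log H.det.re + Real.log G'.det.re := by
    have h1 : (B * H * Bᴴ).det = H.det * G'.det := by
      rw [hBG, det_mul, det_mul, det_mul]; ring
    rw [h1, Complex.mul_re, (hdetpos hH).2, zero_mul, sub_zero,
      Real.log_mul (hdetpos hH).1.ne' (hdetpos hG'p).1.ne']
  have hinv : Real.log G'⁻¹.det.re = -Real.log G'.det.re := by
    have h1 : G'⁻¹.det * G'.det = 1 := by rw [← det_mul, nonsing_inv_mul _ hG'u, det_one]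
    have h2 := congrArg Complex.re h1
    rw [Complex.mul_re, (hdetpos hG'p).2, mul_zero, sub_zero, Complex.one_re] at h2
    rw [eq_inv_of_mul_eq_one_left h2, Real.log_inv]
  have hm := hmin _ hG'p.inv
  rw [hinv, neg_div, sub_neg_eq_add] at hm
  have hge : 0 ≤ (Real.log H.det.re + Real.log G'.det.re) / n := by
    rw [add_div]; linarith
  have hM1 : B * H * Bᴴ = 1 := heq (le_antisymm hle (by
    rw [hdet]
    have := mul_nonneg hge hn.le
    rwa [div_mul_cancel₀ _ hn.ne'] at this))
  have hfin : G' * H = 1 := by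
    have h1 : (H * Bᴴ) * B = 1 := mul_eq_one_comm.1 (by rw [← mul_assoc]; exact hM1)
    rw [mul_eq_one_comm, hBG, ← mul_assoc]
    exact h1
  exact (inv_eq_left_inv hfin).symm

/-! ### Change of coordinates -/

theorem map {R : Matrix (Fin n) (Fin n) ℂ} (hR : IsUnit R.det) :
    StableFrame μ fun x => ‖WithLp.toLp 2 (R *ᵥ z x)‖⁻¹ • R *ᵥ z x := by
  have hinj : Function.Injective R.mulVec :=
    mulVec_injective_of_isUnit ((isUnit_iff_isUnit_det _).2 hR)
  have hne : ∀ x, ‖WithLp.toLp 2 (R *ᵥ z x)‖ ≠ 0 := fun x h => by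
    have h1 : R *ᵥ z x = R *ᵥ 0 := by
      rw [mulVec_zero]; exact congrArg WithLp.ofLp (norm_eq_zero.1 h)
    exact hz.ne_zero x (hinj h1)
  refine ⟨hz.prob, ?_, fun x => ?_, fun W hb ht => ?_⟩
  · have h1 : Measurable fun x => R *ᵥ z x :=
      (Continuous.matrix_mulVec continuous_const continuous_id).measurable.comp hz.measurable
    have h2 : Continuous fun v : Fin n → ℂ => ‖WithLp.toLp 2 v‖ :=
      (PiLp.continuous_toLp 2 _).norm
    exact ((h2.measurable.comp h1).inv).smul h1
  · rw [WithLp.toLp_smul, norm_smul, norm_inv, norm_norm, inv_mul_cancel₀ (hne x)]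
  · let e : (Fin n → ℂ) ≃ₗ[ℂ] (Fin n → ℂ) :=
      LinearEquiv.ofInjectiveEndo (mulVecLin R) hinj
    have he : ∀ v, e v = R *ᵥ v := fun v => rfl
    have h := hz.stable (W.comap (e : (Fin n → ℂ) →ₗ[ℂ] (Fin n → ℂ)))
      (fun h => hb ?_) (fun h => ht ?_)
    · have hset : {x | ‖WithLp.toLp 2 (R *ᵥ z x)‖⁻¹ • R *ᵥ z x ∈ W} =
          {x | z x ∈ W.comap (e : (Fin n → ℂ) →ₗ[ℂ] (Fin n → ℂ))} := by
        ext x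
        simp only [Set.mem_ofPred_eq, Submodule.mem_comap, LinearEquiv.coe_coe, he]
        have : ‖WithLp.toLp 2 (R *ᵥ z x)‖⁻¹ • R *ᵥ z x =
            ((‖WithLp.toLp 2 (R *ᵥ z x)‖⁻¹ : ℝ) : ℂ) • R *ᵥ z x := by
          ext i; simp
        rw [this, W.smul_mem_iff]
        exact_mod_cast inv_ne_zero (hne x)
      rw [hset]
      refine h.trans_le (le_of_eq ?_)
      rw [← LinearEquiv.finrank_map_eq e, Submodule.map_comap_eq_of_surjective e.surjective]
    · rw [← Submodule.map_comap_eq_of_surjective e.surjective W, h, Submodule.map_bot]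
    · rw [← Submodule.map_comap_eq_of_surjective e.surjective W, h, Submodule.map_top,
        LinearMap.range_eq_top.2 e.surjective]

theorem frameMap_conj {R : Matrix (Fin n) (Fin n) ℂ} (hR : IsUnit R.det)
    {G : Matrix (Fin n) (Fin n) ℂ} (hG : G.PosDef) :
    frameMap μ (fun x => ‖WithLp.toLp 2 (R *ᵥ z x)‖⁻¹ • R *ᵥ z x) (R * G * Rᴴ) =
      R * frameMap μ z G * Rᴴ := by
  have hRH : IsUnit Rᴴ.det := by rw [det_conjTranspose]; exact hR.star
  have hne : ∀ x, ‖WithLp.toLp 2 (R *ᵥ z x)‖⁻¹ ≠ 0 := fun x h => by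
    have h1 : R *ᵥ z x = R *ᵥ 0 := by
      rw [mulVec_zero]; exact congrArg WithLp.ofLp (norm_eq_zero.1 (inv_eq_zero.1 h))
    exact hz.ne_zero x (mulVec_injective_of_isUnit ((isUnit_iff_isUnit_det _).2 hR) h1)
  have hpt : ∀ x, (qf (R * G * Rᴴ)⁻¹ (‖WithLp.toLp 2 (R *ᵥ z x)‖⁻¹ • R *ᵥ z x))⁻¹ •
      outer (‖WithLp.toLp 2 (R *ᵥ z x)‖⁻¹ • R *ᵥ z x) =
        R * ((qf G⁻¹ (z x))⁻¹ • outer (z x)) * Rᴴ := fun x => by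
    have h1 : Rᴴ * (R * G * Rᴴ)⁻¹ * R = G⁻¹ := by
      rw [Matrix.mul_inv_rev, Matrix.mul_inv_rev, ← mul_assoc, mul_nonsing_inv _ hRH, one_mul, mul_assoc,
        nonsing_inv_mul _ hR, mul_one]
    rw [qf_smul_right, outer_smul, ← qf_conj, h1, outer_mulVec, smul_smul, mul_inv, mul_right_comm,
      inv_mul_cancel₀ (pow_ne_zero 2 (hne x)), one_mul, mul_smul_comm, smul_mul_assoc]
  let φ : Matrix (Fin n) (Fin n) ℂ →ₗ[ℝ] Matrix (Fin n) (Fin n) ℂ :=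
    { toFun := fun M => R * M * Rᴴ
      map_add' := fun M N => by simp [mul_add, add_mul]
      map_smul' := fun c M => by simp }
  have h := (LinearMap.toContinuousLinearMap φ).integral_comp_comm
    (hz.integrable_smul_outer (hz.integrable_inv_qf hG.inv))
  change ∫ x, R * ((qf G⁻¹ (z x))⁻¹ • outer (z x)) * Rᴴ ∂μ =
    R * (∫ x, (qf G⁻¹ (z x))⁻¹ • outer (z x) ∂μ) * Rᴴ at h
  rw [frameMap, frameMap]
  simp only [hpt]
  rw [h, mul_smul_comm, smul_mul_assoc]

omit hz in
theorem frameMap_smul {c : ℝ} (hc : 0 < c) {G : Matrix (Fin n) (Fin n) ℂ} (hG : G.PosDef) :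
    frameMap μ z (c • G) = c • frameMap μ z G := by
  have hu : IsUnit G.det := (isUnit_iff_isUnit_det _).1 hG.isUnit
  have hinv : (c • G)⁻¹ = c⁻¹ • G⁻¹ := by
    refine inv_eq_left_inv ?_
    rw [smul_mul_smul_comm, inv_mul_cancel₀ hc.ne', nonsing_inv_mul _ hu, one_smul]
  have h : ∫ x, (qf (c • G)⁻¹ (z x))⁻¹ • outer (z x) ∂μ =
      c • ∫ x, (qf G⁻¹ (z x))⁻¹ • outer (z x) ∂μ := by
    rw [hinv, ← integral_smul]
    simp only [qf_smul, mul_inv, inv_inv, mul_smul]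
  rw [frameMap, frameMap, h, smul_comm]

/-- The iterates of `frameMap` converge exponentially to a positive definite fixed point. -/
theorem exists_dist_iterate_le {G₀ : Matrix (Fin n) (Fin n) ℂ} (hG₀ : G₀.PosDef) :
    ∃ G : Matrix (Fin n) (Fin n) ℂ, G.PosDef ∧ frameMap μ z G = G ∧
      ∃ C β : ℝ, 0 < C ∧ 0 < β ∧ β < 1 ∧
        ∀ r : ℕ, dist ((frameMap μ z)^[r] G₀) G ≤ C * β ^ r := by
  obtain ⟨G, hG, hfix⟩ := hz.exists_fixedPoint
  obtain ⟨B, hB, hBG⟩ := exists_eq_conjTranspose_mul_self hG.inv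
  have hGu : IsUnit G.det := (isUnit_iff_isUnit_det _).1 hG.isUnit
  have hBH : IsUnit Bᴴ.det := by rw [det_conjTranspose]; exact hB.star
  have hone : B * G * Bᴴ = 1 := by
    have h1 : (Bᴴ * B) * G = 1 := by rw [← hBG, nonsing_inv_mul _ hGu]
    rw [mul_assoc] at h1
    exact mul_eq_one_comm.1 h1
  have hback : ∀ M : Matrix (Fin n) (Fin n) ℂ, B⁻¹ * (B * M * Bᴴ) * Bᴴ⁻¹ = M := fun M => by
    rw [← mul_assoc, ← mul_assoc, nonsing_inv_mul _ hB, one_mul, mul_assoc, mul_nonsing_inv _ hBH,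
      mul_one]
  have hz' := hz.map hB
  have hbal : frameMap μ (fun x => ‖WithLp.toLp 2 (B *ᵥ z x)‖⁻¹ • B *ᵥ z x) 1 = 1 := by
    rw [← hone, hz.frameMap_conj hB hG, hfix]
  have hiter : ∀ r, (frameMap μ (fun x => ‖WithLp.toLp 2 (B *ᵥ z x)‖⁻¹ • B *ᵥ z x))^[r]
      (B * G₀ * Bᴴ) = B * (frameMap μ z)^[r] G₀ * Bᴴ := by
    intro r
    induction r with
    | zero => rfl
    | succ r ih =>
      rw [Function.iterate_succ_apply', ih, hz.frameMap_conj hB (hz.posDef_iterate hG₀ r),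
        Function.iterate_succ_apply']
  have hG₀' : (B * G₀ * Bᴴ).PosDef :=
    hG₀.mul_mul_conjTranspose_same (vecMul_injective_of_isUnit ((isUnit_iff_isUnit_det _).2 hB))
  obtain ⟨c, C, γ, hc, hC, hγ0, hγ1, hr⟩ := hz'.exists_dist_iterate_le_of_balanced hbal hG₀'
  refine ⟨c • G, hG.smul hc, by rw [frameMap_smul hc hG, hfix],
    (‖B⁻¹‖ * ‖Bᴴ⁻¹‖ + 1) * C, γ, by positivity, hγ0, hγ1, fun r => ?_⟩
  have h1 : (frameMap μ z)^[r] G₀ - c • G =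
      B⁻¹ * (B * (frameMap μ z)^[r] G₀ * Bᴴ - c • (1 : Matrix (Fin n) (Fin n) ℂ)) * Bᴴ⁻¹ := by
    rw [mul_sub, sub_mul, hback, ← hone, mul_smul_comm, smul_mul_assoc, hback]
  rw [dist_eq_norm, h1]
  have h2 := hr r
  rw [hiter] at h2
  have h3 := (frobenius_norm_mul (B⁻¹ * (B * (frameMap μ z)^[r] G₀ * Bᴴ -
    c • (1 : Matrix (Fin n) (Fin n) ℂ))) Bᴴ⁻¹).trans
    (mul_le_mul_of_nonneg_right (frobenius_norm_mul _ _) (norm_nonneg _))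
  refine h3.trans ?_
  have h4 : 0 ≤ C * γ ^ r := by positivity
  calc _ = ‖B⁻¹‖ * ‖Bᴴ⁻¹‖ * ‖B * (frameMap μ z)^[r] G₀ * Bᴴ -
        c • (1 : Matrix (Fin n) (Fin n) ℂ)‖ := by ring
    _ ≤ ‖B⁻¹‖ * ‖Bᴴ⁻¹‖ * (C * γ ^ r) := by gcongr
    _ ≤ _ := by linarith

end StableFrame

/-! ### A measurable choice of unit vectors on projective space -/

theorem herm_eq_star_dotProduct (z w : Fin n → ℂ) : herm z w = star w ⬝ᵥ z := by
  rw [dotProduct_comm]; rfl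

theorem herm_smul_smul (a : ℂ) (z w : Fin n → ℂ) :
    herm (a • z) (a • w) = a * star a * herm z w := by
  simp only [herm, Pi.smul_apply, smul_eq_mul, star_mul', Finset.mul_sum]
  exact Finset.sum_congr rfl fun i _ => by ring

theorem herm_self (z : Fin n → ℂ) : herm z z = ((‖WithLp.toLp 2 z‖ ^ 2 : ℝ) : ℂ) := by
  rw [herm_eq_star_dotProduct, ← qf_one, ← star_dotProduct_eq_qf isHermitian_one, one_mulVec]

theorem herm_self_ne_zero {z : Fin n → ℂ} (hz : z ≠ 0) : herm z z ≠ 0 := by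
  rw [herm_self]
  simpa using hz

theorem lineProj_smul {a : ℂ} (ha : a ≠ 0) (z : Fin n → ℂ) :
    lineProj (a • z) = lineProj z := by
  ext i j
  simp only [lineProj, of_apply, herm_smul_smul, Pi.smul_apply, smul_eq_mul, star_mul']
  have : star a ≠ 0 := star_ne_zero.2 ha
  rw [← mul_div_mul_left (z i * star (z j)) (herm z z) (mul_ne_zero ha this)]
  ring_nf

theorem lineProj_rep_mk (v : Fin n → ℂ) (hv : v ≠ 0) :
    lineProj (Projectivization.mk ℂ v hv).rep = lineProj v := by
  obtain ⟨a, ha⟩ := Projectivization.exists_smul_eq_mk_rep ℂ v hv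
  rw [← ha, Units.smul_def, lineProj_smul a.ne_zero]

theorem continuous_lineProj_rep_apply (i j : Fin n) :
    Continuous fun x : CProj n => lineProj x.rep i j := by
  have hq : IsQuotientMap (Quotient.mk (projectivizationSetoid ℂ (Fin n → ℂ))) :=
    isQuotientMap_quotient_mk'
  have hv : ∀ k, Continuous fun v : {v : Fin n → ℂ // v ≠ 0} => v.1 k := fun k =>
    (continuous_apply k).comp continuous_subtype_val
  have hh : Continuous fun v : {v : Fin n → ℂ // v ≠ 0} => herm v.1 v.1 :=
    continuous_finsetSum _ fun k _ => (hv k).mul (hv k).star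
  have hc := ((hv i).mul (hv j).star).div hh fun v => herm_self_ne_zero v.2
  exact hq.continuous_iff.2 (hc.congr fun v =>
    (congrFun (congrFun (lineProj_rep_mk v.1 v.2) i) j).symm)

/-- The first non-zero column of the projector `Π_x`. -/
def firstCol (x : CProj n) (j : Fin n) : ℂ :=
  open Classical in
  ∑ i, if lineProj x.rep i i ≠ 0 ∧ ∀ k < i, lineProj x.rep k k = 0 then lineProj x.rep j i else 0

theorem measurable_firstCol : Measurable (firstCol (n := n)) := by
  have hm : ∀ i j : Fin n, Measurable fun x : CProj n => lineProj x.rep i j := fun i j =>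
    (continuous_lineProj_rep_apply i j).measurable
  refine measurable_pi_lambda _ fun j => ?_
  unfold firstCol
  refine Finset.measurable_sum _ fun i _ => Measurable.ite ?_ (hm j i) measurable_const
  refine MeasurableSet.inter ?_ ?_
  · exact (measurableSet_eq_fun (hm i i) measurable_const).compl
  · have : {x : CProj n | ∀ k < i, lineProj x.rep k k = 0} =
        ⋂ k, ⋂ (_ : k < i), {x : CProj n | lineProj x.rep k k = 0} := by
      ext x; simp
    change MeasurableSet {x : CProj n | ∀ k < i, lineProj x.rep k k = 0}
    rw [this]
    exact .iInter fun k => .iInter fun _ => measurableSet_eq_fun (hm k k) measurable_const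

theorem exists_firstCol_eq_smul (x : CProj n) : ∃ c : ℂ, c ≠ 0 ∧ firstCol x = c • x.rep := by
  classical
  have hh := herm_self_ne_zero x.rep_nonzero
  have hdiag : ∀ i, lineProj x.rep i i = 0 ↔ x.rep i = 0 := fun i => by
    simp [lineProj, hh]
  have hex : (Finset.univ.filter fun i => x.rep i ≠ 0).Nonempty := by
    obtain ⟨i, hi⟩ := Function.ne_iff.1 x.rep_nonzero
    exact ⟨i, by simpa using hi⟩
  obtain ⟨i, hi, hmin⟩ := Finset.exists_min_image _ id hex
  simp only [Finset.mem_filter, Finset.mem_univ, true_and, id] at hi hmin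
  refine ⟨star (x.rep i) / herm x.rep x.rep, div_ne_zero (star_ne_zero.2 hi) hh, ?_⟩
  funext j
  rw [firstCol, Finset.sum_eq_single i]
  · rw [if_pos]
    · simp only [lineProj, of_apply, Pi.smul_apply, smul_eq_mul]
      ring
    · refine ⟨fun h => hi ((hdiag i).1 h), fun k hk => (hdiag k).2 ?_⟩
      by_contra h
      exact absurd (hmin k h) (not_le.2 hk)
  · intro k _ hk
    rw [if_neg]
    rintro ⟨h1, h2⟩
    rcases lt_trichotomy k i with h | h | h
    · exact absurd (hmin k fun h0 => h1 ((hdiag k).2 h0)) (not_le.2 h)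
    · exact hk h
    · exact hi ((hdiag i).1 (h2 i h))
  · simp

/-- A measurable choice of a unit vector on each line. -/
def unitRep (x : CProj n) : Fin n → ℂ := ‖WithLp.toLp 2 (firstCol x)‖⁻¹ • firstCol x

theorem measurable_unitRep : Measurable (unitRep (n := n)) := by
  have h2 : Continuous fun v : Fin n → ℂ => ‖WithLp.toLp 2 v‖ :=
    (PiLp.continuous_toLp 2 _).norm
  exact ((h2.measurable.comp measurable_firstCol).inv).smul measurable_firstCol

theorem firstCol_norm_ne_zero (x : CProj n) : ‖WithLp.toLp 2 (firstCol x)‖ ≠ 0 := by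
  obtain ⟨c, hc, h⟩ := exists_firstCol_eq_smul x
  simp [h, hc, x.rep_nonzero]

theorem norm_unitRep (x : CProj n) : ‖WithLp.toLp 2 (unitRep x)‖ = 1 := by
  rw [unitRep, WithLp.toLp_smul, norm_smul, norm_inv, norm_norm,
    inv_mul_cancel₀ (firstCol_norm_ne_zero x)]

theorem exists_unitRep_eq_smul (x : CProj n) : ∃ c : ℂ, c ≠ 0 ∧ unitRep x = c • x.rep := by
  obtain ⟨c, hc, h⟩ := exists_firstCol_eq_smul x
  refine ⟨(‖WithLp.toLp 2 (firstCol x)‖⁻¹ : ℝ) * c, mul_ne_zero ?_ hc, ?_⟩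
  · exact_mod_cast inv_ne_zero (firstCol_norm_ne_zero x)
  · rw [unitRep]
    conv_lhs => rw [h]
    ext i
    simp [mul_assoc, h]

theorem unitRep_mem_iff (W : Submodule ℂ (Fin n → ℂ)) (x : CProj n) :
    unitRep x ∈ W ↔ x ∈ W.projectivization := by
  obtain ⟨c, hc, h⟩ := exists_unitRep_eq_smul x
  rw [h, W.smul_mem_iff hc]
  conv_rhs => rw [← x.mk_rep]
  rw [Submodule.mk_mem_projectivization_iff]

theorem integrand_eq {G : Matrix (Fin n) (Fin n) ℂ} (hG : G.PosDef) (x : CProj n) :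
    (herm x.rep x.rep / herm (G⁻¹ *ᵥ x.rep) x.rep) • lineProj x.rep =
      (qf G⁻¹ (unitRep x))⁻¹ • outer (unitRep x) := by
  obtain ⟨c, hc, h⟩ := exists_unitRep_eq_smul x
  have hcc : c * star c ≠ 0 := mul_ne_zero hc (star_ne_zero.2 hc)
  have h1 : herm (unitRep x) (unitRep x) = 1 := by
    rw [herm_self, norm_unitRep]; simp
  have h2 : herm x.rep x.rep / herm (G⁻¹ *ᵥ x.rep) x.rep = (((qf G⁻¹ (unitRep x))⁻¹ : ℝ) : ℂ) := by
    rw [← mul_div_mul_left _ _ hcc, ← herm_smul_smul, ← herm_smul_smul, ← mulVec_smul, ← h, h1,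
      herm_eq_star_dotProduct, star_dotProduct_eq_qf hG.inv.1]
    simp
  have h3 : lineProj x.rep = outer (unitRep x) := by
    rw [← lineProj_smul hc, ← h]
    ext i j
    simp [lineProj, h1, outer, vecMulVec_apply]
  rw [h2, h3]
  rfl

theorem stableFrame_unitRep (ν : Measure (CProj n)) [IsFiniteMeasure ν] (hν : ν ≠ 0)
    (hi : ∀ L : Projectivization.Subspace ℂ (Fin n → ℂ), L ≠ ⊥ → L ≠ ⊤ →
      ν.real (L : Set (CProj n)) /
          (Module.finrank ℂ (Projectivization.Subspace.submodule L) : ℝ)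
        < ν.real Set.univ / (n : ℝ)) :
    StableFrame ((ν Set.univ)⁻¹ • ν) (unitRep (n := n)) := by
  have hν0 : ν Set.univ ≠ 0 := by simpa using hν
  have hpos : 0 < ν.real Set.univ := ENNReal.toReal_pos hν0 (measure_ne_top _ _)
  refine ⟨⟨?_⟩, measurable_unitRep, norm_unitRep, fun W hb ht => ?_⟩
  · rw [Measure.smul_apply, smul_eq_mul, ENNReal.inv_mul_cancel hν0 (measure_ne_top _ _)]
  · have h := hi W.projectivization (by simpa using hb) (by simpa using ht)
    have hset : {x : CProj n | unitRep x ∈ W} = (W.projectivization : Set (CProj n)) := by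
      ext x
      exact unitRep_mem_iff W x
    have hsub : Projectivization.Subspace.submodule W.projectivization = W :=
      OrderIso.apply_symm_apply _ _
    have hW : (0 : ℝ) < Module.finrank ℂ W := by
      exact_mod_cast Nat.pos_of_ne_zero fun h0 => hb (Submodule.finrank_eq_zero.1 h0)
    have hn : (0 : ℝ) < n := by
      refine hW.trans_le ?_
      have h3 := Submodule.finrank_le W
      rw [Module.finrank_fin_fun] at h3
      exact_mod_cast h3
    rw [hsub, div_lt_div_iff₀ hW hn] at h
    rw [hset, measureReal_ennreal_smul_apply, ENNReal.toReal_inv, ← measureReal_def,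
      inv_mul_eq_div, div_lt_div_iff₀ hpos hn]
    linarith

theorem T_eq_frameMap (ν : Measure (CProj n)) {G : Matrix (Fin n) (Fin n) ℂ} (hG : G.PosDef) :
    T ν G = frameMap ((ν Set.univ)⁻¹ • ν) unitRep G := by
  rw [T, frameMap, integral_smul_measure, ENNReal.toReal_inv, ← measureReal_def, smul_smul,
    div_eq_mul_inv]
  simp only [integrand_eq hG]

end Donaldson

end

theorem corollary4p8 {n : ℕ} (ν : Measure (Donaldson.CProj n)) [IsFiniteMeasure ν] (hν : ν ≠ 0)
    -- `ν` is supported on a complex variety `Y` and absolutely continuous on its components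
    (Y : Set (Donaldson.CProj n)) (hY : Donaldson.IsVariety Y) (hsupp : ν Yᶜ = 0)
    (hac : ∀ Z, Donaldson.IsComponent Y Z → Donaldson.AbsContOn ν Z)
    -- (i), for all non-empty proper projective subspaces; `finrank` is `dim L + 1`
    (hi : ∀ L : Projectivization.Subspace ℂ (Fin n → ℂ), L ≠ ⊥ → L ≠ ⊤ →
      ν.real (L : Set (Donaldson.CProj n)) /
          (Module.finrank ℂ (Projectivization.Subspace.submodule L) : ℝ)
        < ν.real Set.univ / (n : ℝ))
    -- (ii)
    (hii : ∃ Z, Donaldson.IsComponent Y Z ∧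
      ∀ L : Projectivization.Subspace ℂ (Fin n → ℂ), Z ⊆ (L : Set (Donaldson.CProj n)) → L = ⊤)
    (G₀ : Matrix (Fin n) (Fin n) ℂ) (hG₀ : G₀.PosDef) :
    (∀ r : ℕ, ((Donaldson.T ν)^[r] G₀).PosDef) ∧
    ∃ Ginf : Matrix (Fin n) (Fin n) ℂ, Ginf.PosDef ∧ Donaldson.T ν Ginf = Ginf ∧
      ∃ C β : ℝ, 0 < C ∧ 0 < β ∧ β < 1 ∧
        ∀ r : ℕ, dist ((Donaldson.T ν)^[r] G₀) Ginf ≤ C * β ^ r := by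
  have hz := Donaldson.stableFrame_unitRep ν hν hi
  have hiter : ∀ r, (Donaldson.T ν)^[r] G₀ =
      (Donaldson.frameMap ((ν Set.univ)⁻¹ • ν) Donaldson.unitRep)^[r] G₀ := by
    intro r
    induction r with
    | zero => rfl
    | succ r ih =>
      rw [Function.iterate_succ_apply', Function.iterate_succ_apply', ih,
        Donaldson.T_eq_frameMap ν (hz.posDef_iterate hG₀ r)]
  refine ⟨fun r => hiter r ▸ hz.posDef_iterate hG₀ r, ?_⟩
  obtain ⟨G, hG, hfix, C, β, hC, hβ0, hβ1, hr⟩ := hz.exists_dist_iterate_le hG₀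
  refine ⟨G, hG, (Donaldson.T_eq_frameMap ν hG).trans hfix, C, β, hC, hβ0, hβ1, fun r => ?_⟩
  rw [hiter]
  exact hr r
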